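/- Let $\mu>0$ and $0<b<1/\sqrt2$. Let $M=\mathbb R\times[-1,1]$ with $(t,-1)\equiv(t,1)$ be the cylinder with Lebesgue measure, and let $\mathcal I_b=\{n\in\mathbb Z:|n|<1/(\sqrt2\,b)\}$. For $\operatorname{Re}\tau\ge0$ and $x\in\mathbb R$ with $e^{-\pi\tau\pm\pi i x}\neq1$ put $$g(\tau,x)=-\tfrac{\pi\tau}{2}-\tfrac12\log(1-e^{-\pi\tau+\pi i x})-\tfrac12\log(1-e^{-\pi\tau-\pi i x})$$ (principal logarithm). Let $k\ge1$, $\boldsymbol n=(n_1,\dots,n_k)\in\mathcal I_b^k$, $\alpha_j=bn_j$, $w=-\sum_j n_j$, and let $u_j=(t_j,x_j)$, $j=1,\dots,k$, be points satisfying the non-light-cone condition $(t_j-t_{j'})\pm(x_j-x_{j'})\notin2\mathbb Z$ for all $j<j'$. Put $v_j=(it_j,x_j)$, and let $\gamma$ be the contour that runs horizontally from $it_1-\infty$ to $it_1$, then vertically to $it_2$, then to $it_3$, and so on to $it_k$, then horizontally to $it_k+\infty$. For two points $p,q$ of the tube $M_\gamma=\gamma\times[-1,1]$, let $\mathcal T(p-q)$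 be the coordinatewise difference (the one visited later along $\gamma$) minus (the one visited earlier), where $v_1,\dots,v_k$ are visited in this order (with arbitrary choices on the null set of remaining ties). The Lorentzian correlator is $$C^{\mathrm L}_{b\boldsymbol n}(u_1,\dots,u_k)=\frac{(-\mu)^w}{w!}\exp\Big\{-4\sum_{j<j'}\alpha_j\alpha_{j'}\,g(\mathcal T(v_j-v_{j'}))\Big\}\int_{M_\gamma^w}\exp\Big\{-4b\sum_{j=1}^k\sum_{l=1}^w\alpha_j\,g(\mathcal T(v_j-z_l))-4b^2\sum_{l<l'}g(\mathcal T(z_l-z_{l'}))\Big\}\,dz_1\cdots dz_w$$ if $w\ge0$, where the integral is a contour integral in the first coordinate of each $z_l$ and a Lebesgue integral over $[-1,1]$ in the second, and equals $1$ if $w=0$. If $w<0$, then $C^{\mathrm L}_{b\boldsymbol n}=0$. Let $\mathcal A$ be the tensor algebra of $\bigoplus_{n\in\mathcal I_b}C_c^\infty(M,\mathbb C)$, with generators $\mathcal O_{f,n}$ linear in $f$, and with the conjugate-linear, anti-multiplicative involution determined by $1^*=1$ and $\mathcal O_{f,n}^*=\mathcal O_{\bar f,n}$. **Theorem (Hermiticity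 of the algebraic form).** (a) For all $k\ge1$, $f_j\in C_c^\infty(M,\mathbb C)$ and $n_j\in\mathcal I_b$, the integral $\int_{M^k}\prod_j f_j(u_j)\,C^{\mathrm L}_{b\boldsymbol n}(u_1,\dots,u_k)\,du_1\cdots du_k$ converges absolutely, and there is a unique linear functional $\omega:\mathcal A\to\mathbb C$ with $\omega(1)=1$ whose value on every monomial $\mathcal O_{f_1,n_1}\cdots\mathcal O_{f_k,n_k}$ is this integral (the Lorentzian vacuum functional). (b) The form $\langle A,B\rangle=\omega(A^*B)$ is Hermitian: $\langle A,B\rangle=\overline{\langle B,A\rangle}$ for all $A,B\in\mathcal A$. (c) For all $k\ge1$, $\boldsymbol n\in\mathcal I_b^k$ and $u_1,\dots,u_k$ satisfying the non-light-cone condition, the contour integral defining the correlator converges absolutely (when $w\ge0$), and $$C^{\mathrm L}_{bn_1,\dots,bn_k}(u_1,\dots,u_k)=\overline{C^{\mathrm L}_{bn_k,\dots,bn_1}(u_k,\dots,u_1)}.$$ -/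

import Mathlib

open MeasureTheory
open scoped DirectSum ComplexConjugate

noncomputable section

namespace TimelikeLiouville

/-! ### The Green's function and the contour -/

/-- The Green's function of the cylinder, continued analytically in time:
`g(τ, x) = -πτ/2 - (1/2) log(1 - e^{-πτ+πix}) - (1/2) log(1 - e^{-πτ-πix})`.
For `Re τ ≥ 0` both arguments of the principal logarithm have nonnegative real part. -/
def green (τ : ℂ) (x : ℝ) : ℂ :=
  -(Real.pi * τ / 2)
    - (1 / 2) * Complex.log (1 - Complex.exp (-(Real.pi * τ) + Real.pi * Complex.I * x))
    - (1 / 2) * Complex.log (1 - Complex.exp (-(Real.pi * τ) - Real.pi * Complex.I * x))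

/-- The contour through `i t₀, i t₁, …, i t_k` (in index order), parametrized by `s ∈ ℝ`:
horizontal from `i t₀ - ∞` to `i t₀` for `s ≤ 0`, the vertical segment from `i t_j` to `i t_{j+1}`
for `j ≤ s ≤ j + 1`, and horizontal from `i t_k` to `i t_k + ∞` for `s ≥ k`.
The `j`-th insertion is visited at the parameter `s = j`. -/
def contour {k : ℕ} (t : Fin (k + 1) → ℝ) (s : ℝ) : ℂ :=
  ((min s 0 + max (s - k) 0 : ℝ) : ℂ)
    + Complex.I *
      ((t 0 + ∑ j : Fin k, (t j.succ - t j.castSucc) * max 0 (min 1 (s - (j : ℕ))) : ℝ) : ℂ)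

/-- `g(𝒯(p - q))` for two marked points of the tube `γ × [-1,1]`, each given by its contour
parameter and its space coordinate: the point with the larger parameter comes first. -/
def orderedGreen {k : ℕ} (t : Fin (k + 1) → ℝ) (p q : ℝ × ℝ) : ℂ :=
  if q.1 ≤ p.1 then green (contour t p.1 - contour t q.1) (p.2 - q.2)
  else green (contour t q.1 - contour t p.1) (q.2 - p.2)

/-- The `j`-th external insertion as a marked point of the tube: contour parameter `j` and
space coordinate `x_j`. -/
def insertion {k : ℕ} (v : Fin (k + 1) → ℝ × ℝ) (j : Fin (k + 1)) : ℝ × ℝ :=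
  (((j : ℕ) : ℝ), (v j).2)

/-- Lebesgue measure on the fundamental domain `ℝ × [-1,1]` of the cylinder. -/
def cylinderMeasure : Measure (ℝ × ℝ) :=
  volume.restrict (Set.univ ×ˢ Set.Icc (-1 : ℝ) 1)

instance : SigmaFinite cylinderMeasure := by
  unfold cylinderMeasure; infer_instance

/-! ### The Lorentzian correlator -/

/-- The integrand of the `w`-fold contour integral over `(γ × [-1,1])^w`, pulled back to the
parameters: `u l = (s_l, x_l)`, including the factors `γ'(s_l)`. The insertion points are
`v j = (t_j, x_j)` and the charges are `α j`. -/
def screeningIntegrand {k : ℕ} (b : ℝ) (w : ℕ) (α : Fin (k + 1) → ℂ) (v : Fin (k + 1) → ℝ × ℝ)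
    (u : Fin w → ℝ × ℝ) : ℂ :=
  Complex.exp
      (-4 * b * ∑ j, ∑ l, α j * orderedGreen (fun i => (v i).1) (insertion v j) (u l)
        - 4 * b ^ 2 * ∑ l, ∑ l' ∈ Finset.Ioi l, orderedGreen (fun i => (v i).1) (u l) (u l'))
    * ∏ l, deriv (contour fun i => (v i).1) (u l).1

/-- The contour formula for the Lorentzian correlator with `w` screening insertions. -/
def screenedCorrelator {k : ℕ} (b μ : ℝ) (w : ℕ) (α : Fin (k + 1) → ℂ)
    (v : Fin (k + 1) → ℝ × ℝ) : ℂ :=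
  ((-μ) ^ w / (w.factorial : ℝ) : ℝ)
    * Complex.exp (-4 * ∑ j, ∑ j' ∈ Finset.Ioi j,
        α j * α j' * orderedGreen (fun i => (v i).1) (insertion v j) (insertion v j'))
    * ∫ u, screeningIntegrand b w α v u ∂(Measure.pi fun _ : Fin w => cylinderMeasure)

/-- The screening number `-∑ n_j`. -/
def screeningNumber {k : ℕ} (n : Fin (k + 1) → ℤ) : ℤ := -∑ j, n j

/-- The charges `α_j = b n_j`. -/
def charges {k : ℕ} (b : ℝ) (n : Fin (k + 1) → ℤ) : Fin (k + 1) → ℂ := fun j => b * n j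

/-- The Lorentzian correlator with charges `b n_j`; it vanishes if the screening number is
negative. -/
def lorentzCorrelator {k : ℕ} (b μ : ℝ) (n : Fin (k + 1) → ℤ) (v : Fin (k + 1) → ℝ × ℝ) : ℂ :=
  if 0 ≤ screeningNumber n then
    screenedCorrelator b μ (screeningNumber n).toNat (charges b n) v
  else 0

/-- No difference of two insertion points is null: `Δt ± Δx ∉ 2ℤ`. -/
def NonLightCone {k : ℕ} (v : Fin (k + 1) → ℝ × ℝ) : Prop :=
  ∀ i j, i < j → ∀ m : ℤ,
    ((v i).1 - (v j).1) + ((v i).2 - (v j).2) ≠ 2 * m ∧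
    ((v i).1 - (v j).1) - ((v i).2 - (v j).2) ≠ 2 * m

/-! ### The algebra of smeared observables -/

/-- `C_c^∞(M, ℂ)` for the cylinder `M = ℝ × (ℝ / 2ℤ)`: smooth functions on `ℝ²` that are
`2`-periodic in the second variable and vanish for large `|t|`. -/
def TestFn : Submodule ℂ (ℝ × ℝ → ℂ) where
  carrier := {f | ContDiff ℝ (⊤ : ℕ∞) f ∧ (∀ t x, f (t, x + 2) = f (t, x)) ∧
    ∃ R : ℝ, ∀ t x, R < |t| → f (t, x) = 0}
  add_mem' := by
    rintro f g ⟨hf, pf, R, hR⟩ ⟨hg, pg, S, hS⟩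
    refine ⟨hf.add hg, fun t x => by simp [pf, pg], max R S, fun t x h => ?_⟩
    simp [hR t x ((le_max_left _ _).trans_lt h), hS t x ((le_max_right _ _).trans_lt h)]
  zero_mem' := ⟨contDiff_const, fun _ _ => rfl, 0, fun _ _ _ => rfl⟩
  smul_mem' := by
    rintro c f ⟨hf, pf, R, hR⟩
    exact ⟨contDiff_const.smul hf, fun t x => by simp [pf], R, fun t x h => by simp [hR t x h]⟩

/-- Pointwise complex conjugation of a test function. -/
def conjFn (f : TestFn) : TestFn :=
  ⟨fun p => starRingEnd ℂ (f.1 p), by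
    obtain ⟨hf, pf, R, hR⟩ := f.2
    exact ⟨Complex.conjCLE.contDiff.comp hf, fun t x => by simp [pf], R,
      fun t x h => by simp [hR t x h]⟩⟩

/-- The admissible integer charges `|n| < 1 / (√2 b)`. -/
def chargeSet (b : ℝ) : Set ℤ := {n | |(n : ℝ)| < 1 / (Real.sqrt 2 * b)}

/-- The space of generators: one copy of `C_c^∞(M, ℂ)` for every admissible charge. -/
abbrev Gen (b : ℝ) : Type := ⨁ _ : chargeSet b, TestFn

/-- The ordered algebra: the tensor algebra over the generators. -/
abbrev Alg (b : ℝ) : Type := TensorAlgebra ℂ (Gen b)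

/-- The basic smeared observable `𝒪_{f,n}`. -/
def obs {b : ℝ} (f : TestFn) (n : chargeSet b) : Alg b :=
  TensorAlgebra.ι ℂ (DirectSum.lof ℂ (chargeSet b) (fun _ => TestFn) n f)

/-- The ordered monomial `𝒪_{f₀,n₀} 𝒪_{f₁,n₁} ⋯ 𝒪_{f_k,n_k}`. -/
def word {b : ℝ} {k : ℕ} (f : Fin (k + 1) → TestFn) (n : Fin (k + 1) → chargeSet b) : Alg b :=
  (List.ofFn fun j => obs (f j) (n j)).prod

/-! ### The involution -/

/-- Complex conjugation of generators, componentwise. -/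
def conjGen (b : ℝ) : Gen b →+ Gen b :=
  DirectSum.map fun _ =>
    { toFun := conjFn
      map_zero' := by ext p; simp [conjFn]
      map_add' := fun f g => by ext p; simp [conjFn] }

lemma conjGen_lof {b : ℝ} (n : chargeSet b) (f : TestFn) :
    conjGen b (DirectSum.lof ℂ (chargeSet b) (fun _ => TestFn) n f)
      = DirectSum.lof ℂ (chargeSet b) (fun _ => TestFn) n (conjFn f) :=
  DirectSum.map_of _ _ _

lemma conjGen_smul {b : ℝ} (c : ℂ) (x : Gen b) :
    conjGen b (c • x) = conj c • conjGen b x := by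
  induction x using DirectSum.induction_on with
  | zero => simp
  | of n f =>
    change conjGen b (c • DirectSum.lof ℂ (chargeSet b) (fun _ => TestFn) n f)
      = conj c • conjGen b (DirectSum.lof ℂ (chargeSet b) (fun _ => TestFn) n f)
    rw [← map_smul, conjGen_lof, conjGen_lof, ← map_smul]
    congr 1
    ext p
    simp [conjFn]
  | add x y hx hy => rw [smul_add, map_add, map_add, hx, hy, smul_add]

lemma conjGen_conjGen {b : ℝ} (x : Gen b) : conjGen b (conjGen b x) = x := by
  induction x using DirectSum.induction_on with
  | zero => simp
  | of n f =>
    change conjGen b (conjGen b (DirectSum.lof ℂ (chargeSet b) (fun _ => TestFn) n f))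
      = DirectSum.lof ℂ (chargeSet b) (fun _ => TestFn) n f
    rw [conjGen_lof, conjGen_lof]
    congr 1
    ext p
    simp [conjFn]
  | add x y hx hy => rw [map_add, map_add, hx, hy]

/-- The opposite algebra with complex-conjugated scalar multiplication. -/
def ConjOp (b : ℝ) : Type := (Alg b)ᵐᵒᵖ

instance (b : ℝ) : Ring (ConjOp b) := inferInstanceAs (Ring (Alg b)ᵐᵒᵖ)

instance (b : ℝ) : Algebra ℂ (ConjOp b) :=
  RingHom.toAlgebra' ((algebraMap ℂ (Alg b)ᵐᵒᵖ).comp (starRingEnd ℂ))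
    fun c x => Algebra.commutes (A := (Alg b)ᵐᵒᵖ) (conj c) x

lemma ConjOp.smul_def {b : ℝ} (c : ℂ) (x : ConjOp b) :
    c • x = (MulOpposite.op (conj c • MulOpposite.unop (α := Alg b) x) : (Alg b)ᵐᵒᵖ) := by
  exact (Algebra.smul_def (A := (Alg b)ᵐᵒᵖ) (conj c) x).symm

/-- The involution, as a homomorphism into the conjugate opposite algebra: the unique extension
of `𝒪_{f,n} ↦ 𝒪_{f̄,n}`. -/
def starHom (b : ℝ) : Alg b →ₐ[ℂ] ConjOp b :=
  TensorAlgebra.lift ℂ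
    { toFun := fun x => (MulOpposite.op (TensorAlgebra.ι ℂ (conjGen b x)) : (Alg b)ᵐᵒᵖ)
      map_add' := fun x y => by rw [map_add, map_add]; rfl
      map_smul' := fun c x => by
        rw [conjGen_smul, map_smul]
        exact (ConjOp.smul_def c _).symm }

/-- The involution of the algebra. -/
instance (b : ℝ) : Star (Alg b) := ⟨fun A => MulOpposite.unop (α := Alg b) (starHom b A)⟩

lemma star_def {b : ℝ} (A : Alg b) : star A = MulOpposite.unop (α := Alg b) (starHom b A) := rfl

lemma star_ι {b : ℝ} (x : Gen b) :
    star (TensorAlgebra.ι ℂ x : Alg b) = TensorAlgebra.ι ℂ (conjGen b x) := by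
  rw [star_def, starHom, TensorAlgebra.lift_ι_apply]
  rfl

lemma star_obs {b : ℝ} (f : TestFn) (n : chargeSet b) : star (obs f n) = obs (conjFn f) n := by
  rw [obs, star_ι, conjGen_lof, obs]

lemma star_mul_alg {b : ℝ} (A B : Alg b) : star (A * B) = star B * star A := by
  rw [star_def, map_mul]; rfl

lemma star_add_alg {b : ℝ} (A B : Alg b) : star (A + B) = star A + star B := by
  rw [star_def, map_add]; rfl

lemma star_algebraMap_alg {b : ℝ} (c : ℂ) :
    star (algebraMap ℂ (Alg b) c) = algebraMap ℂ (Alg b) (conj c) := by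
  rw [star_def, AlgHom.commutes]; rfl

instance (b : ℝ) : StarRing (Alg b) where
  star_involutive := fun A => by
    induction A using TensorAlgebra.induction with
    | algebraMap c => rw [star_algebraMap_alg, star_algebraMap_alg, Complex.conj_conj]
    | ι x => rw [star_ι, star_ι, conjGen_conjGen]
    | mul A B hA hB => rw [star_mul_alg, star_mul_alg, hA, hB]
    | add A B hA hB => rw [star_add_alg, star_add_alg, hA, hB]
  star_mul := star_mul_alg
  star_add := star_add_alg

instance (b : ℝ) : StarModule ℂ (Alg b) where
  star_smul := fun c A => by
    rw [Algebra.smul_def, star_mul_alg, star_algebraMap_alg, ← Algebra.commutes,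
      ← Algebra.smul_def]
    rfl

/-! ### The vacuum functional -/

/-- The integrand `∏ f_j(u_j) · C^L_{bn}(u_0, …, u_k)` of a smeared vacuum expectation. -/
def smearedIntegrand {b : ℝ} (μ : ℝ) {k : ℕ} (f : Fin (k + 1) → TestFn)
    (n : Fin (k + 1) → chargeSet b) (u : Fin (k + 1) → ℝ × ℝ) : ℂ :=
  (∏ j, (f j).1 (u j)) * lorentzCorrelator b μ (fun j => (n j : ℤ)) u

/-- `ω` is the vacuum functional: linear, `ω(1) = 1`, and on ordered monomials of positive length
it is the smeared Lorentzian vacuum expectation. -/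
def IsVacuumFunctional (b μ : ℝ) (ω : Alg b →ₗ[ℂ] ℂ) : Prop :=
  ω 1 = 1 ∧
    ∀ (k : ℕ) (f : Fin (k + 1) → TestFn) (n : Fin (k + 1) → chargeSet b),
      ω (word f n) =
        ∫ u, smearedIntegrand μ f n u ∂(Measure.pi fun _ : Fin (k + 1) => cylinderMeasure)

end TimelikeLiouville

end

noncomputable section

namespace TimelikeLiouville

/-! ### The contour -/

section Contour

variable {k : ℕ} (t : Fin (k + 1) → ℝ)

lemma contour_re (s : ℝ) : (contour t s).re = min s 0 + max (s - k) 0 := by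
  simp only [contour, Complex.add_re, Complex.ofReal_re, Complex.I_mul_re, Complex.ofReal_im,
    neg_zero, add_zero]

lemma contour_im (s : ℝ) : (contour t s).im =
    t 0 + ∑ j : Fin k, (t j.succ - t j.castSucc) * max 0 (min 1 (s - (j : ℕ))) := by
  simp only [contour, Complex.add_im, Complex.ofReal_im, Complex.I_mul_im, Complex.ofReal_re,
    zero_add]

lemma contour_re_mono {s s' : ℝ} (h : s ≤ s') : (contour t s).re ≤ (contour t s').re := by
  rw [contour_re, contour_re]
  gcongr

lemma contour_re_natCast (j : Fin (k + 1)) : (contour t (j : ℕ)).re = 0 := by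
  have h : ((j : ℕ) : ℝ) ≤ k := by exact_mod_cast Fin.is_le j
  rw [contour_re, min_eq_right (Nat.cast_nonneg _), max_eq_right (by linarith), add_zero]

lemma sum_sub_mul_clamp_natCast (t : ℕ → ℝ) (k j : ℕ) (hj : j ≤ k) :
    ∑ i ∈ Finset.range k, (t (i + 1) - t i) * max 0 (min 1 ((j : ℝ) - (i : ℝ))) = t j - t 0 := by
  rw [← Finset.sum_range_sub, ← Finset.sum_subset (Finset.range_subset_range.2 hj)]
  · refine Finset.sum_congr rfl fun i hi => ?_
    have h : (i : ℝ) + 1 ≤ j := by exact_mod_cast Finset.mem_range.1 hi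
    rw [min_eq_left (by linarith), max_eq_right zero_le_one, mul_one]
  · intro i _ hi
    have h : (j : ℝ) ≤ i := by exact_mod_cast not_lt.1 fun h => hi (Finset.mem_range.2 h)
    rw [max_eq_left ((min_le_right _ _).trans (by linarith)), mul_zero]

lemma contour_im_natCast (j : Fin (k + 1)) : (contour t (j : ℕ)).im = t j := by
  have key := sum_sub_mul_clamp_natCast (fun i => t (Fin.ofNat (k + 1) i)) k j (Fin.is_le j)
  rw [contour_im, ← sub_eq_iff_eq_add'.1 (sub_eq_iff_eq_add'.2 rfl)]
  rw [← Fin.sum_univ_eq_sum_range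
    (fun i => (t (Fin.ofNat (k + 1) (i + 1)) - t (Fin.ofNat (k + 1) i)) *
      max 0 (min 1 (((j : ℕ) : ℝ) - (i : ℝ)))) k] at key
  have h1 : Fin.ofNat (k + 1) (j : ℕ) = j := by ext; simp
  have h0 : Fin.ofNat (k + 1) 0 = 0 := rfl
  rw [h1, h0] at key
  have h2 : ∀ i : Fin k, t (Fin.ofNat (k + 1) ((i : ℕ) + 1)) - t (Fin.ofNat (k + 1) (i : ℕ)) =
      t i.succ - t i.castSucc := fun i => by
    congr 2 <;> ext <;> simp [Nat.mod_eq_of_lt, i.2]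
  simp only [h2] at key
  rw [key]; ring

lemma sum_contour_increments : ∑ j : Fin k, (t j.succ - t j.castSucc) = t (Fin.last k) - t 0 := by
  have h := contour_im_natCast t (Fin.last k)
  rw [contour_im] at h
  rw [← h, add_sub_cancel_left]
  refine Finset.sum_congr rfl fun j _ => ?_
  have h : ((j : ℕ) : ℝ) + 1 ≤ k := by exact_mod_cast j.2
  rw [min_eq_left (by simp; linarith), max_eq_right zero_le_one, mul_one]

lemma clamp_one_sub (s : ℝ) : max 0 (min 1 (1 - s)) = 1 - max 0 (min 1 s) := by
  rcases le_total s 0 with h | h <;> rcases le_total s 1 with h' | h' <;> simp [*]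
  linarith

lemma contour_rev (s : ℝ) :
    contour (fun j => t j.rev) (k - s) = -conj (contour t s) := by
  apply Complex.ext
  · rw [Complex.neg_re, Complex.conj_re, contour_re, contour_re]
    have h1 : min ((k : ℝ) - s) 0 = -max (s - k) 0 := by
      rw [← min_neg_neg, neg_sub, neg_zero]
    have h2 : max ((k : ℝ) - s - k) 0 = -min s 0 := by
      rw [← max_neg_neg, neg_zero]; ring_nf
    rw [h1, h2]; ring
  · rw [Complex.neg_im, Complex.conj_im, neg_neg, contour_im, contour_im,
      ← Equiv.sum_comp Fin.revPerm]
    have h : ∀ j : Fin k, (t (Fin.revPerm j).succ.rev - t (Fin.revPerm j).castSucc.rev) *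
        max 0 (min 1 ((k : ℝ) - s - ((Fin.revPerm j : Fin k) : ℕ))) =
        (t j.succ - t j.castSucc) * max 0 (min 1 (s - (j : ℕ))) - (t j.succ - t j.castSucc) := by
      intro j
      have hj : (((Fin.rev j : Fin k) : ℕ) : ℝ) = k - 1 - (j : ℕ) := by
        rw [Fin.val_rev, Nat.cast_sub j.2]; push_cast; ring
      rw [Fin.revPerm_apply, Fin.rev_succ, Fin.rev_castSucc, Fin.rev_rev, hj,
        show (k : ℝ) - s - (k - 1 - (j : ℕ)) = 1 - (s - (j : ℕ)) by ring, clamp_one_sub]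
      ring
    rw [Finset.sum_congr rfl fun j _ => h j, Finset.sum_sub_distrib, sum_contour_increments,
      Fin.rev_zero]
    ring

lemma deriv_contour_rev (s : ℝ) :
    deriv (contour fun j => t j.rev) (k - s) = conj (deriv (contour t) s) := by
  have h1 : deriv (fun s => contour (fun j => t j.rev) (k - s)) s =
      -deriv (contour fun j => t j.rev) (k - s) := deriv_comp_const_sub _ _ _
  have h2 : (fun s => contour (fun j => t j.rev) (k - s)) = -fun s => conj (contour t s) :=
    funext fun s => contour_rev t s
  have h3 : deriv (fun s => conj (contour t s)) s = conj (deriv (contour t) s) :=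
    deriv.star
  rw [h2, deriv.neg, h3] at h1
  exact (neg_injective h1).symm

end Contour

/-! ### The Green's function under reflection -/

lemma log_one_sub_exp_conj {z : ℂ} (hz : z.re ≤ 0) :
    Complex.log (1 - Complex.exp (conj z)) = conj (Complex.log (1 - Complex.exp z)) := by
  rw [Complex.exp_conj, ← Complex.log_conj, map_sub, map_one]
  have h : 0 ≤ (1 - Complex.exp z).re := by
    rw [Complex.sub_re, Complex.one_re, sub_nonneg]
    exact (Complex.re_le_norm _).trans ((Complex.norm_exp z).trans_le (Real.exp_le_one_iff.2 hz))
  intro h'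
  rw [Complex.arg_eq_pi_iff] at h'
  linarith [h'.1]

lemma green_neg (τ : ℂ) (x : ℝ) : green τ (-x) = green τ x := by
  simp only [green, Complex.ofReal_neg, mul_neg, sub_neg_eq_add, ← sub_eq_add_neg]
  ring

lemma green_conj {τ : ℂ} (hτ : 0 ≤ τ.re) (x : ℝ) : green (conj τ) x = conj (green τ x) := by
  have hp := mul_nonneg Real.pi_pos.le hτ
  have h1 := log_one_sub_exp_conj (z := -(Real.pi * τ) - Real.pi * Complex.I * x) (by simpa)
  have h2 := log_one_sub_exp_conj (z := -(Real.pi * τ) + Real.pi * Complex.I * x) (by simpa)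
  simp only [map_add, map_sub, map_neg, map_mul, Complex.conj_ofReal, Complex.conj_I, mul_neg,
    neg_mul, sub_neg_eq_add, ← sub_eq_add_neg] at h1 h2
  simp only [green, map_sub, map_neg, map_mul, map_div₀, Complex.conj_ofReal, h1, h2, map_one,
    map_ofNat]
  ring

lemma orderedGreen_comm {k : ℕ} (t : Fin (k + 1) → ℝ) (p q : ℝ × ℝ) :
    orderedGreen t p q = orderedGreen t q p := by
  rcases lt_trichotomy p.1 q.1 with h | h | h
  · simp [orderedGreen, h.le, h.not_ge]
  · simp only [orderedGreen, h, le_refl, if_true, sub_self]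
    rw [← green_neg, neg_sub]
  · simp [orderedGreen, h.le, h.not_ge]

lemma orderedGreen_rev {k : ℕ} (t : Fin (k + 1) → ℝ) (p q : ℝ × ℝ) :
    orderedGreen (fun j => t j.rev) (k - p.1, p.2) (k - q.1, q.2) =
      conj (orderedGreen t p q) := by
  have key : ∀ p q : ℝ × ℝ, q.1 ≤ p.1 →
      orderedGreen (fun j => t j.rev) (k - p.1, p.2) (k - q.1, q.2) =
        conj (orderedGreen t p q) := by
    intro p q h
    rw [orderedGreen_comm, orderedGreen, if_pos (sub_le_sub_left h _), orderedGreen, if_pos h,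
      contour_rev, contour_rev, neg_sub_neg, ← map_sub, green_conj, ← neg_sub p.2, green_neg]
    rw [Complex.sub_re, sub_nonneg]
    exact contour_re_mono t h
  rcases le_total q.1 p.1 with h | h
  · exact key p q h
  · rw [orderedGreen_comm, key q p h, orderedGreen_comm]

lemma insertion_rev {k : ℕ} (v : Fin (k + 1) → ℝ × ℝ) (j : Fin (k + 1)) :
    insertion (fun i => v i.rev) j.rev = (k - (insertion v j).1, (insertion v j).2) := by
  simp only [insertion, Fin.rev_rev, Fin.val_rev]
  rw [Nat.add_sub_add_right, Nat.cast_sub (Fin.is_le j)]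

/-! ### Reversal of the correlator -/

lemma sum_sum_Ioi_rev {k : ℕ} (F : Fin (k + 1) → Fin (k + 1) → ℂ) (hF : ∀ i j, F i j = F j i) :
    ∑ i : Fin (k + 1), ∑ j ∈ Finset.Ioi i, F i.rev j.rev = ∑ i, ∑ j ∈ Finset.Ioi i, F i j := by
  have h : ∀ i : Fin (k + 1), ∑ j ∈ Finset.Ioi i.rev, F i j.rev = ∑ j ∈ Finset.Iio i, F i j := by
    intro i
    refine Finset.sum_nbij' Fin.rev Fin.rev ?_ ?_ ?_ ?_ ?_ <;> simp [Fin.rev_lt_iff, Fin.lt_rev_iff]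
  rw [← Equiv.sum_comp Fin.revPerm]
  simp only [Fin.revPerm_apply, Fin.rev_rev, h]
  rw [Finset.sum_comm' (t' := Finset.univ) (s' := fun j => Finset.Ioi j)
    (fun x y => by simp)]
  exact Finset.sum_congr rfl fun i _ => Finset.sum_congr rfl fun j _ => hF _ _

lemma screeningIntegrand_rev {k : ℕ} (b : ℝ) (w : ℕ) (n : Fin (k + 1) → ℤ)
    (v : Fin (k + 1) → ℝ × ℝ) (u : Fin w → ℝ × ℝ) :
    screeningIntegrand b w (charges b fun j => n j.rev) (fun j => v j.rev)
        (fun l => (k - (u l).1, (u l).2)) =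
      conj (screeningIntegrand b w (charges b n) v u) := by
  unfold screeningIntegrand
  rw [map_mul, ← Complex.exp_conj, map_prod]
  congr 1
  · congr 1
    simp only [map_sub, map_mul, map_neg, map_pow, map_sum, Complex.conj_ofReal, map_ofNat]
    congr 2
    · rw [← Equiv.sum_comp Fin.revPerm]
      refine Finset.sum_congr rfl fun j _ => Finset.sum_congr rfl fun l _ => ?_
      rw [Fin.revPerm_apply, insertion_rev, orderedGreen_rev (fun i => (v i).1)]
      simp [charges]
    · refine Finset.sum_congr rfl fun l _ => Finset.sum_congr rfl fun l' _ => ?_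
      exact orderedGreen_rev (fun i => (v i).1) _ _
  · exact Finset.prod_congr rfl fun l _ => deriv_contour_rev (fun i => (v i).1) _

lemma measurePreserving_const_sub_fst (c : ℝ) :
    MeasurePreserving (fun p : ℝ × ℝ => (c - p.1, p.2)) cylinderMeasure cylinderMeasure := by
  have h : cylinderMeasure = (volume : Measure ℝ).prod (volume.restrict (Set.Icc (-1 : ℝ) 1)) := by
    rw [cylinderMeasure, Measure.volume_eq_prod, ← Measure.prod_restrict, Measure.restrict_univ]
  rw [h]
  exact (Measure.measurePreserving_sub_left volume c).prod (MeasurePreserving.id _)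

lemma integral_screeningIntegrand_rev {k : ℕ} (b : ℝ) (w : ℕ) (n : Fin (k + 1) → ℤ)
    (v : Fin (k + 1) → ℝ × ℝ) :
    ∫ u, screeningIntegrand b w (charges b fun j => n j.rev) (fun j => v j.rev) u
        ∂(Measure.pi fun _ : Fin w => cylinderMeasure) =
      conj (∫ u, screeningIntegrand b w (charges b n) v u
        ∂(Measure.pi fun _ : Fin w => cylinderMeasure)) := by
  let e : ℝ × ℝ ≃ᵐ ℝ × ℝ := (MeasurableEquiv.subLeft (k : ℝ)).prodCongr (MeasurableEquiv.refl ℝ)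
  have h := (measurePreserving_pi (fun _ : Fin w => cylinderMeasure)
    (fun _ : Fin w => cylinderMeasure)
    fun _ : Fin w => measurePreserving_const_sub_fst (k : ℝ)).integral_comp
    (MeasurableEquiv.piCongrRight fun _ : Fin w => e).measurableEmbedding
    (screeningIntegrand b w (charges b fun j => n j.rev) (fun j => v j.rev))
  rw [← h, ← integral_conj]
  exact integral_congr_ae (Filter.Eventually.of_forall fun u =>
    screeningIntegrand_rev b w n v u)

lemma screeningNumber_rev {k : ℕ} (n : Fin (k + 1) → ℤ) :
    screeningNumber (fun j => n j.rev) = screeningNumber n := by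
  rw [screeningNumber, screeningNumber, ← Equiv.sum_comp Fin.revPerm n]
  rfl

lemma screenedCorrelator_rev {k : ℕ} (b μ : ℝ) (w : ℕ) (n : Fin (k + 1) → ℤ)
    (v : Fin (k + 1) → ℝ × ℝ) :
    screenedCorrelator b μ w (charges b fun j => n j.rev) (fun j => v j.rev) =
      conj (screenedCorrelator b μ w (charges b n) v) := by
  unfold screenedCorrelator
  rw [integral_screeningIntegrand_rev, map_mul, map_mul, Complex.conj_ofReal, ← Complex.exp_conj]
  congr 3
  simp only [map_mul, map_neg, map_sum, map_ofNat]
  congr 1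
  let F : Fin (k + 1) → Fin (k + 1) → ℂ := fun j j' => conj (charges b n j) *
    conj (charges b n j') *
      conj (orderedGreen (fun i => (v i).1) (insertion v j) (insertion v j'))
  rw [← sum_sum_Ioi_rev F fun i j => by simp only [F]; rw [orderedGreen_comm]; ring]
  refine Finset.sum_congr rfl fun j _ => Finset.sum_congr rfl fun j' _ => ?_
  simp only [F]
  rw [← orderedGreen_rev, ← insertion_rev, ← insertion_rev, Fin.rev_rev, Fin.rev_rev]
  simp [charges]

/-- Reversing the order of the insertions conjugates the correlator. -/
lemma lorentzCorrelator_rev {k : ℕ} (b μ : ℝ) (n : Fin (k + 1) → ℤ) (v : Fin (k + 1) → ℝ × ℝ) :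
    lorentzCorrelator b μ (fun j => n j.rev) (fun j => v j.rev) =
      conj (lorentzCorrelator b μ n v) := by
  unfold lorentzCorrelator
  rw [screeningNumber_rev, screenedCorrelator_rev]
  split_ifs <;> simp

/-! ### Words span the algebra -/

section Algebra

variable {b : ℝ}

lemma adjoin_range_obs :
    Algebra.adjoin ℂ (Set.range fun p : TestFn × chargeSet b => obs p.1 p.2) = ⊤ := by
  refine top_unique ?_
  rw [← TensorAlgebra.adjoin_range_ι, Algebra.adjoin_le_iff]
  rintro _ ⟨x, rfl⟩
  induction x using DirectSum.induction_on with
  | zero => rw [map_zero]; exact zero_mem _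
  | of n f => exact Algebra.subset_adjoin ⟨(f, n), rfl⟩
  | add x y hx hy => rw [map_add]; exact add_mem hx hy

/-- Additive maps out of the algebra vanish if they vanish on scalars times words. -/
lemma alg_induction {P : Alg b → Prop} (one : ∀ c : ℂ, P (c • 1))
    (word : ∀ (c : ℂ) (k : ℕ) (f : Fin (k + 1) → TestFn) (n : Fin (k + 1) → chargeSet b),
      P (c • word f n))
    (add : ∀ A B, P A → P B → P (A + B)) (A : Alg b) : P A := by
  have hA : A ∈ Subalgebra.toSubmodule
      (Algebra.adjoin ℂ (Set.range fun p : TestFn × chargeSet b => obs p.1 p.2)) := by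
    rw [adjoin_range_obs]; trivial
  rw [Algebra.adjoin_eq_span] at hA
  refine Submodule.closure_induction (p := fun A _ => P A) (by simpa using one 0)
    (fun x y _ _ => add x y) ?_ hA
  intro c x hx
  obtain ⟨l, hl, rfl⟩ := Submonoid.exists_list_of_mem_closure hx
  rcases l with _ | ⟨a, l⟩
  · exact one c
  · have h : ∀ j : Fin (l.length + 1), ∃ p : TestFn × chargeSet b,
        obs p.1 p.2 = (a :: l).get j := fun j => hl _ (List.get_mem _ _)
    choose p hp using h
    have := word c l.length (fun j => (p j).1) (fun j => (p j).2)
    simp only [TimelikeLiouville.word, hp] at this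
    exact (List.ofFn_get (a :: l)) ▸ this

lemma reverse_ofFn {α : Type*} {m : ℕ} (f : Fin m → α) :
    (List.ofFn f).reverse = List.ofFn fun j => f j.rev := by
  refine List.ext_getElem (by simp) fun i h h' => ?_
  simp only [List.getElem_reverse, List.getElem_ofFn, List.length_ofFn]
  congr 1
  ext
  simp [Fin.val_rev]
  omega

lemma star_word {k : ℕ} (f : Fin (k + 1) → TestFn) (n : Fin (k + 1) → chargeSet b) :
    star (word f n) = word (fun j => conjFn (f j.rev)) (fun j => n j.rev) := by
  have h : ∀ l : List (Alg b), star l.prod = (l.map star).reverse.prod := by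
    intro l
    induction l with
    | nil => simp
    | cons a l ih => simp [ih]
  rw [word, word, h, List.map_ofFn, reverse_ofFn]
  simp only [Function.comp_apply, star_obs]

/-! ### Hermiticity -/

variable {μ : ℝ}

lemma smearedIntegrand_rev {k : ℕ} (f : Fin (k + 1) → TestFn) (n : Fin (k + 1) → chargeSet b)
    (u : Fin (k + 1) → ℝ × ℝ) :
    smearedIntegrand μ (fun j => conjFn (f j.rev)) (fun j => n j.rev) (fun j => u j.rev) =
      conj (smearedIntegrand μ f n u) := by
  unfold smearedIntegrand
  rw [lorentzCorrelator_rev b μ (fun j => (n j : ℤ)), map_mul, map_prod,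
    ← Equiv.prod_comp Fin.revPerm]
  simp [conjFn]

lemma IsVacuumFunctional.map_star_word {ω : Alg b →ₗ[ℂ] ℂ} (hω : IsVacuumFunctional b μ ω) {k : ℕ}
    (f : Fin (k + 1) → TestFn) (n : Fin (k + 1) → chargeSet b) :
    ω (star (word f n)) = conj (ω (word f n)) := by
  rw [star_word, hω.2, hω.2, ← integral_conj]
  have h := (measurePreserving_piCongrLeft (fun _ : Fin (k + 1) => cylinderMeasure)
    Fin.revPerm).integral_comp (MeasurableEquiv.measurableEmbedding _)
    (smearedIntegrand μ (fun j => conjFn (f j.rev)) fun j => n j.rev)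
  rw [← h]
  refine integral_congr_ae (Filter.Eventually.of_forall fun u => ?_)
  dsimp only
  rw [← smearedIntegrand_rev]
  congr 1
  funext j
  have := MeasurableEquiv.piCongrLeft_apply_apply (β := fun _ : Fin (k + 1) => ℝ × ℝ)
    Fin.revPerm u j.rev
  simpa using this

lemma IsVacuumFunctional.map_star {ω : Alg b →ₗ[ℂ] ℂ} (hω : IsVacuumFunctional b μ ω)
    (A : Alg b) : ω (star A) = conj (ω A) := by
  induction A using alg_induction with
  | one c => rw [star_smul, star_one, map_smul, map_smul, hω.1]; simp
  | word c k f n => rw [star_smul, map_smul, map_smul, hω.map_star_word]; simp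
  | add A B hA hB => rw [star_add, map_add, map_add, hA, hB, map_add]

lemma IsVacuumFunctional.hermitian {ω : Alg b →ₗ[ℂ] ℂ} (hω : IsVacuumFunctional b μ ω)
    (A B : Alg b) : ω (star A * B) = conj (ω (star B * A)) := by
  rw [← hω.map_star, star_mul, star_star]

/-! ### Existence and uniqueness of the vacuum functional -/

lemma IsVacuumFunctional.unique {ω ω' : Alg b →ₗ[ℂ] ℂ} (hω : IsVacuumFunctional b μ ω)
    (hω' : IsVacuumFunctional b μ ω') : ω = ω' := by
  ext1
  rename_i A
  induction A using alg_induction with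
  | one c => rw [map_smul, map_smul, hω.1, hω'.1]
  | word c k f n => rw [map_smul, map_smul, hω.2, hω'.2]
  | add A B hA hB => rw [map_add, map_add, hA, hB]

lemma finite_chargeSet (b : ℝ) : (chargeSet b).Finite := by
  refine (Set.finite_Icc (-⌈1 / (Real.sqrt 2 * b)⌉) ⌈1 / (Real.sqrt 2 * b)⌉).subset fun n hn => ?_
  have h : -(1 / (Real.sqrt 2 * b)) < n ∧ (n : ℝ) < 1 / (Real.sqrt 2 * b) := abs_lt.1 hn
  have h' := Int.le_ceil (1 / (Real.sqrt 2 * b))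
  constructor
  · have : (-⌈1 / (Real.sqrt 2 * b)⌉ : ℝ) ≤ n := by linarith
    exact_mod_cast this
  · have : (n : ℝ) ≤ ⌈1 / (Real.sqrt 2 * b)⌉ := by linarith
    exact_mod_cast this

instance (b : ℝ) : Fintype (chargeSet b) := (finite_chargeSet b).fintype

lemma prod_update_apply {ι : Type*} [Fintype ι] [DecidableEq ι] (f : ι → TestFn) (i : ι)
    (x : TestFn) (u : ι → ℝ × ℝ) :
    ∏ j, (Function.update f i x j).1 (u j) =
      x.1 (u i) * ∏ j ∈ Finset.univ.erase i, (f j).1 (u j) := by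
  rw [← Finset.mul_prod_erase _ _ (Finset.mem_univ i), Function.update_self]
  congr 1
  refine Finset.prod_congr rfl fun j hj => ?_
  rw [Function.update_of_ne (Finset.ne_of_mem_erase hj)]

variable (hint : ∀ (k : ℕ) (f : Fin (k + 1) → TestFn) (n : Fin (k + 1) → chargeSet b),
  Integrable (smearedIntegrand μ f n) (Measure.pi fun _ => cylinderMeasure))

/-- The smeared expectation with fixed charges as a multilinear map in the test functions. -/
def smearedMultilinear (k : ℕ) (n : Fin (k + 1) → chargeSet b) :
    MultilinearMap ℂ (fun _ : Fin (k + 1) => TestFn) ℂ where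
  toFun f := ∫ u, smearedIntegrand μ f n u ∂(Measure.pi fun _ : Fin (k + 1) => cylinderMeasure)
  map_update_add' f i x y := by
    rw [← integral_add (hint k _ n) (hint k _ n)]
    congr 1
    funext u
    simp only [smearedIntegrand, prod_update_apply, Submodule.coe_add, Pi.add_apply]
    ring
  map_update_smul' f i c x := by
    rw [smul_eq_mul, ← integral_const_mul]
    congr 1
    funext u
    simp only [smearedIntegrand, prod_update_apply, Submodule.coe_smul, Pi.smul_apply,
      smul_eq_mul]
    ring

/-- The smeared expectation as a multilinear map on the generators. -/
def genMultilinear (k : ℕ) : MultilinearMap ℂ (fun _ : Fin (k + 1) => Gen b) ℂ :=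
  ∑ n : Fin (k + 1) → chargeSet b, (smearedMultilinear hint k n).compLinearMap
    fun j => DirectSum.component ℂ (chargeSet b) (fun _ => TestFn) (n j)

lemma genMultilinear_lof (k : ℕ) (f : Fin (k + 1) → TestFn) (n : Fin (k + 1) → chargeSet b) :
    genMultilinear hint k (fun j => DirectSum.lof ℂ (chargeSet b) (fun _ => TestFn) (n j) (f j)) =
      ∫ u, smearedIntegrand μ f n u ∂(Measure.pi fun _ : Fin (k + 1) => cylinderMeasure) := by
  rw [genMultilinear, sum_apply, Finset.sum_eq_single n]
  · simp only [MultilinearMap.compLinearMap_apply, DirectSum.component.lof_self]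
    rfl
  · intro m _ hm
    obtain ⟨j, hj⟩ := Function.ne_iff.1 hm
    rw [MultilinearMap.compLinearMap_apply]
    refine MultilinearMap.map_coord_zero _ j ?_
    rw [DirectSum.component.of, dif_neg (Ne.symm hj)]
  · exact fun h => (h (Finset.mem_univ _)).elim

/-- The graded pieces of the vacuum functional. -/
def vacuumPiece : ∀ k : ℕ, MultilinearMap ℂ (fun _ : Fin k => Gen b) ℂ
  | 0 => MultilinearMap.constOfIsEmpty ℂ _ 1
  | k + 1 => genMultilinear hint k

/-- The vacuum functional, assembled from its graded pieces. -/
def vacuumFunctional : Alg b →ₗ[ℂ] ℂ :=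
  (DirectSum.toModule ℂ ℕ ℂ fun k => PiTensorProduct.lift (vacuumPiece hint k)) ∘ₗ
    (TensorAlgebra.equivDirectSum (R := ℂ) (M := Gen b)).toLinearMap

lemma vacuumFunctional_tprod (k : ℕ) (x : Fin k → Gen b) :
    vacuumFunctional hint (TensorAlgebra.tprod ℂ (Gen b) k x) = vacuumPiece hint k x := by
  rw [vacuumFunctional, LinearMap.comp_apply, AlgEquiv.toLinearMap_apply,
    TensorAlgebra.equivDirectSum_apply, TensorAlgebra.toDirectSum_tensorPower_tprod,
    ← DirectSum.lof_eq_of ℂ, DirectSum.toModule_lof, PiTensorProduct.lift.tprod]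

lemma isVacuumFunctional_vacuumFunctional :
    IsVacuumFunctional b μ (vacuumFunctional hint) := by
  constructor
  · have h := vacuumFunctional_tprod hint 0 Fin.elim0
    rw [TensorAlgebra.tprod_apply, List.ofFn_zero, List.prod_nil] at h
    rw [h]; rfl
  · intro k f n
    rw [← genMultilinear_lof hint, word]
    simp only [obs]
    rw [← TensorAlgebra.tprod_apply ℂ, vacuumFunctional_tprod, vacuumPiece]

end Algebra

/-! ### Chords and gaps -/

/-- The chord `|1 - e^{πiθ}|` of the circle `ℝ / 2ℤ`. -/
def chord (θ : ℝ) : ℝ := ‖1 - Complex.exp (Real.pi * θ * Complex.I)‖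

/-- The modulus `|1 - e^{-πσ + πiθ}|`. -/
def gap (σ θ : ℝ) : ℝ := ‖1 - Complex.exp (-(Real.pi * σ) + Real.pi * θ * Complex.I)‖

lemma gap_zero_left (θ : ℝ) : gap 0 θ = chord θ := by simp [gap, chord]

lemma gap_nonneg (σ θ : ℝ) : 0 ≤ gap σ θ := norm_nonneg _

lemma chord_nonneg (θ : ℝ) : 0 ≤ chord θ := norm_nonneg _

@[fun_prop]
lemma continuous_chord : Continuous chord := by unfold chord; fun_prop

lemma norm_exp_gap (σ θ : ℝ) :
    ‖Complex.exp (-(Real.pi * σ) + Real.pi * θ * Complex.I)‖ = Real.exp (-(Real.pi * σ)) := by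
  rw [Complex.norm_exp]; simp

lemma gap_neg_right (σ θ : ℝ) : gap σ (-θ) = gap σ θ := by
  rw [gap, gap, ← Complex.norm_conj, map_sub, map_one, ← Complex.exp_conj]
  simp

lemma chord_neg (θ : ℝ) : chord (-θ) = chord θ := by
  rw [← gap_zero_left, ← gap_zero_left, gap_neg_right]

lemma gap_le_two {σ : ℝ} (hσ : 0 ≤ σ) (θ : ℝ) : gap σ θ ≤ 2 := by
  refine (norm_sub_le _ _).trans ?_
  rw [norm_exp_gap, norm_one]
  have := Real.exp_le_one_iff.2 (neg_nonpos.2 (mul_nonneg Real.pi_pos.le hσ))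
  linarith

lemma chord_le_two (θ : ℝ) : chord θ ≤ 2 := by
  rw [← gap_zero_left]; exact gap_le_two le_rfl θ

lemma one_sub_exp_le_gap (σ θ : ℝ) : 1 - Real.exp (-(Real.pi * σ)) ≤ gap σ θ := by
  have := norm_sub_norm_le 1 (Complex.exp (-(Real.pi * σ) + Real.pi * θ * Complex.I))
  rwa [norm_exp_gap, norm_one] at this

lemma norm_exp_gap_sub {σ δ : ℝ} (hσ : 0 ≤ σ) (hδ : 0 ≤ δ) (θ : ℝ) :
    ‖Complex.exp (-(Real.pi * σ) + Real.pi * θ * Complex.I) -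
      Complex.exp (-(Real.pi * (σ + δ : ℝ)) + Real.pi * θ * Complex.I)‖ ≤
      1 - Real.exp (-(Real.pi * δ)) := by
  have h : Complex.exp (-(Real.pi * (σ + δ : ℝ)) + Real.pi * θ * Complex.I) =
      Complex.exp (-(Real.pi * σ) + Real.pi * θ * Complex.I) *
        (Real.exp (-(Real.pi * δ)) : ℝ) := by
    rw [Complex.ofReal_exp, ← Complex.exp_add]; congr 1; push_cast; ring
  have h1 := Real.exp_le_one_iff.2 (neg_nonpos.2 (mul_nonneg Real.pi_pos.le hσ))
  have h2 := Real.exp_le_one_iff.2 (neg_nonpos.2 (mul_nonneg Real.pi_pos.le hδ))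
  have h3 : (1 : ℂ) - (Real.exp (-(Real.pi * δ)) : ℝ) = (1 - Real.exp (-(Real.pi * δ)) : ℝ) := by
    push_cast; ring
  rw [h, ← mul_one_sub, norm_mul, norm_exp_gap, h3, Complex.norm_real, Real.norm_eq_abs,
    abs_of_nonneg (by linarith)]
  exact mul_le_of_le_one_left (by linarith) h1

lemma gap_le_two_mul_gap_add {σ δ : ℝ} (hσ : 0 ≤ σ) (hδ : 0 ≤ δ) (θ : ℝ) :
    gap σ θ ≤ 2 * gap (σ + δ) θ := by
  have h1 := norm_exp_gap_sub hσ hδ θ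
  have h2 := one_sub_exp_le_gap (σ + δ) θ
  have h3 : Real.exp (-(Real.pi * (σ + δ))) ≤ Real.exp (-(Real.pi * δ)) :=
    Real.exp_le_exp.2 (by nlinarith [Real.pi_pos])
  have h4 : gap σ θ ≤ gap (σ + δ) θ + ‖Complex.exp (-(Real.pi * σ) + Real.pi * θ * Complex.I) -
      Complex.exp (-(Real.pi * (σ + δ : ℝ)) + Real.pi * θ * Complex.I)‖ := by
    rw [norm_sub_rev (Complex.exp _)]
    refine le_trans (le_of_eq ?_) (norm_add_le _ _)
    rw [gap]; congr 1; ring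
  linarith

lemma gap_add_le {σ δ : ℝ} (hσ : 0 ≤ σ) (hδ : 0 ≤ δ) (θ : ℝ) :
    gap (σ + δ) θ ≤ gap σ θ + Real.pi * δ := by
  have h1 := norm_exp_gap_sub hσ hδ θ
  have h2 := Real.add_one_le_exp (-(Real.pi * δ))
  have h4 : gap (σ + δ) θ ≤ gap σ θ + ‖Complex.exp (-(Real.pi * σ) + Real.pi * θ * Complex.I) -
      Complex.exp (-(Real.pi * (σ + δ : ℝ)) + Real.pi * θ * Complex.I)‖ := by
    refine le_trans (le_of_eq ?_) (norm_add_le _ _)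
    rw [gap]; congr 1; ring
  linarith

lemma chord_add_le (α β : ℝ) : chord (α + β) ≤ chord α + chord β := by
  have h : (1 : ℂ) - Complex.exp (Real.pi * (α + β : ℝ) * Complex.I) =
      (1 - Complex.exp (Real.pi * α * Complex.I)) +
      Complex.exp (Real.pi * α * Complex.I) * (1 - Complex.exp (Real.pi * β * Complex.I)) := by
    rw [mul_sub, ← Complex.exp_add]; push_cast; ring_nf
  rw [chord, h]
  refine (norm_add_le _ _).trans_eq ?_
  rw [norm_mul, show (Real.pi * α * Complex.I : ℂ) = (Real.pi * α : ℝ) * Complex.I by push_cast; rfl,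
    Complex.norm_exp_ofReal_mul_I, one_mul]
  simp [chord]

lemma chord_eq (θ : ℝ) : chord θ = 2 * |Real.sin (Real.pi * θ / 2)| := by
  have := Complex.norm_exp_I_mul_ofReal_sub_one (Real.pi * θ)
  rw [chord, norm_sub_rev, mul_comm _ Complex.I,
    show (Real.pi * θ : ℂ) = (Real.pi * θ : ℝ) by push_cast; rfl, this, norm_mul]
  simp

lemma chord_le_pi_mul (θ : ℝ) : chord θ ≤ Real.pi * |θ| := by
  have := Real.abs_sin_le_abs (x := Real.pi * θ / 2)
  rw [abs_div, abs_mul, abs_of_pos Real.pi_pos, abs_of_pos (two_pos (α := ℝ))] at this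
  rw [chord_eq]; linarith

lemma two_mul_abs_le_chord {θ : ℝ} (h : |θ| ≤ 1) : 2 * |θ| ≤ chord θ := by
  have h1 : Real.pi * |θ| / 2 ≤ Real.pi / 2 := by nlinarith [Real.pi_pos]
  have := Real.mul_le_sin (x := Real.pi * |θ| / 2) (by positivity) h1
  have h2 : |Real.sin (Real.pi * θ / 2)| = |Real.sin (Real.pi * |θ| / 2)| := by
    rcases abs_choice θ with h | h <;> rw [h]
    rw [mul_neg, neg_div, Real.sin_neg, abs_neg]
  rw [chord_eq, h2]
  have h3 : 2 / Real.pi * (Real.pi * |θ| / 2) = |θ| := by field_simp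
  linarith [le_abs_self (Real.sin (Real.pi * |θ| / 2))]

lemma chord_periodic : Function.Periodic chord 2 := by
  intro θ
  rw [chord_eq, chord_eq, show Real.pi * (θ + 2) / 2 = Real.pi * θ / 2 + Real.pi by ring,
    Real.sin_add_pi, abs_neg]

lemma chord_pos {θ : ℝ} (h : ∀ m : ℤ, θ ≠ 2 * m) : 0 < chord θ := by
  rw [chord_eq]
  refine mul_pos two_pos (abs_pos.2 fun h0 => ?_)
  obtain ⟨m, hm⟩ := Real.sin_eq_zero_iff.1 h0
  apply h m
  have := Real.pi_pos.ne'
  field_simp at hm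
  linarith

lemma chord_le_two_mul_gap {σ : ℝ} (hσ : 0 ≤ σ) (θ : ℝ) : chord θ ≤ 2 * gap σ θ := by
  have := gap_le_two_mul_gap_add le_rfl hσ θ
  rwa [zero_add, gap_zero_left] at this

/-- Trading imaginary for real displacement decreases the modulus at most by a constant factor. -/
lemma chord_add_le_gap {σ ρ : ℝ} (h : |ρ| ≤ σ) (θ : ℝ) : chord (θ + ρ) ≤ 5 * gap σ θ := by
  have hσ : 0 ≤ σ := (abs_nonneg ρ).trans h
  have h1 := chord_add_le θ ρ
  have h2 := chord_le_two_mul_gap hσ θ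
  have h3 := one_sub_exp_le_gap σ θ
  have h4 := chord_le_pi_mul ρ
  have h5 := chord_le_two ρ
  have hy : Real.pi * |ρ| ≤ Real.pi * σ := by gcongr
  set y := Real.pi * σ
  have hy0 : 0 ≤ y := mul_nonneg Real.pi_pos.le hσ
  have h6 : Real.exp (-y) * (1 + y) ≤ 1 := by
    rw [Real.exp_neg, inv_mul_le_iff₀ (Real.exp_pos y), mul_one, add_comm]
    exact Real.add_one_le_exp y
  have h7 : y ≤ (1 - Real.exp (-y)) * (1 + y) := by nlinarith
  have h8 : chord ρ ≤ 3 * (1 - Real.exp (-y)) := by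
    have : chord ρ * (1 + y) ≤ 3 * (1 - Real.exp (-y)) * (1 + y) := by nlinarith
    exact le_of_mul_le_mul_right this (by linarith)
  linarith

/-! ### The real part of the Green's function -/

lemma green_re (τ : ℂ) (x : ℝ) : (green τ x).re =
    -(Real.pi * τ.re / 2) - 1 / 2 * Real.log (gap τ.re (τ.im - x))
      - 1 / 2 * Real.log (gap τ.re (τ.im + x)) := by
  have h1 : (-(Real.pi * τ) + Real.pi * Complex.I * x : ℂ) =
      -(Real.pi * τ.re) + Real.pi * (-(τ.im - x) : ℝ) * Complex.I := by
    apply Complex.ext <;> simp; ring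
  have h2 : (-(Real.pi * τ) - Real.pi * Complex.I * x : ℂ) =
      -(Real.pi * τ.re) + Real.pi * (-(τ.im + x) : ℝ) * Complex.I := by
    apply Complex.ext <;> simp; ring
  rw [green, h1, h2, ← gap_neg_right, ← gap_neg_right _ (τ.im + x)]
  have h3 : (1 / 2 : ℂ) = ((1 / 2 : ℝ) : ℂ) := by push_cast; rfl
  rw [h3, Complex.sub_re, Complex.sub_re, Complex.re_ofReal_mul, Complex.re_ofReal_mul,
    Complex.log_re, Complex.log_re, gap, gap]
  simp

lemma orderedGreen_re {k : ℕ} (t : Fin (k + 1) → ℝ) (p q : ℝ × ℝ) : (orderedGreen t p q).re =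
    -(Real.pi / 2 * |(contour t p.1).re - (contour t q.1).re|)
      - 1 / 2 * Real.log (gap |(contour t p.1).re - (contour t q.1).re|
          (((contour t p.1).im - p.2) - ((contour t q.1).im - q.2)))
      - 1 / 2 * Real.log (gap |(contour t p.1).re - (contour t q.1).re|
          (((contour t p.1).im + p.2) - ((contour t q.1).im + q.2))) := by
  have key : ∀ p q : ℝ × ℝ, q.1 ≤ p.1 → (orderedGreen t p q).re =
    -(Real.pi / 2 * |(contour t p.1).re - (contour t q.1).re|)
      - 1 / 2 * Real.log (gap |(contour t p.1).re - (contour t q.1).re|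
          (((contour t p.1).im - p.2) - ((contour t q.1).im - q.2)))
      - 1 / 2 * Real.log (gap |(contour t p.1).re - (contour t q.1).re|
          (((contour t p.1).im + p.2) - ((contour t q.1).im + q.2))) := by
    intro p q h
    rw [orderedGreen, if_pos h, green_re, abs_of_nonneg (sub_nonneg.2 (contour_re_mono t h)),
      Complex.sub_re, Complex.sub_im]
    congr 3
    · ring
    · congr 2; ring
    · congr 1; ring
  rcases le_total q.1 p.1 with h | h
  · exact key p q h
  · rw [orderedGreen_comm, key q p h, abs_sub_comm, ← neg_sub ((contour t p.1).im - p.2),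
      gap_neg_right, ← neg_sub ((contour t p.1).im + p.2), gap_neg_right]

/-! ### Positivity of the regularized energy -/

section Energy

variable {ι : Type*} [Fintype ι]

lemma sum_mul_exp_neg_abs_nonneg (a σ : ι → ℝ) {m : ℝ} (hm : 0 ≤ m) :
    0 ≤ ∑ i, ∑ j, a i * a j * Real.exp (-(m * |σ i - σ j|)) := by
  have h := posSemidef_matrix_measure_inter (ι := ι) (μ := (volume : Measure ℝ))
    (s := fun i => Set.Ioc 0 (Real.exp (2 * m * σ i))) (fun _ => measurableSet_Ioc)
    (fun _ => measure_Ioc_lt_top.ne)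
  have h' := h.dotProduct_mulVec_nonneg fun i => a i * Real.exp (-(m * σ i))
  rw [star_trivial] at h'
  refine h'.trans_eq ?_
  simp only [dotProduct, Matrix.mulVec, Matrix.of_apply, Finset.mul_sum]
  refine Finset.sum_congr rfl fun i _ => Finset.sum_congr rfl fun j _ => ?_
  rw [Set.Ioc_inter_Ioc, max_self, Real.volume_real_Ioc, sub_zero,
    max_eq_left (le_min (Real.exp_pos _).le (Real.exp_pos _).le)]
  have h2 : Real.exp (-(m * |σ i - σ j|)) = Real.exp (-(m * σ i)) * Real.exp (-(m * σ j)) *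
      min (Real.exp (2 * m * σ i)) (Real.exp (2 * m * σ j)) := by
    rcases le_total (σ i) (σ j) with hij | hij
    · rw [min_eq_left (Real.exp_le_exp.2 (by gcongr)), abs_of_nonpos (by linarith),
        ← Real.exp_add, ← Real.exp_add]
      ring_nf
    · rw [min_eq_right (Real.exp_le_exp.2 (by gcongr)), abs_of_nonneg (by linarith),
        ← Real.exp_add, ← Real.exp_add]
      ring_nf
  rw [h2]; ring

lemma hasSum_neg_log_gap {σ : ℝ} (hσ : 0 < σ) (θ : ℝ) :
    HasSum (fun n : ℕ => Real.exp (-(n * Real.pi * σ)) * Real.cos (n * Real.pi * θ) / n)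
      (-Real.log (gap σ θ)) := by
  have h := Complex.hasSum_re (Complex.hasSum_taylorSeries_neg_log
    (z := Complex.exp (-(Real.pi * σ) + Real.pi * θ * Complex.I)) (by
      rw [norm_exp_gap, Real.exp_lt_one_iff, neg_lt_zero]
      exact mul_pos Real.pi_pos hσ))
  rw [Complex.neg_re, Complex.log_re] at h
  have h' : ∀ n : ℕ, (Complex.exp (-(Real.pi * σ) + Real.pi * θ * Complex.I) ^ n / n).re =
      Real.exp (-(n * Real.pi * σ)) * Real.cos (n * Real.pi * θ) / n := fun n => by
    rw [Complex.div_natCast_re, ← Complex.exp_nat_mul, Complex.exp_re]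
    congr 2
    · simp; ring
    · simp; ring_nf
  simp only [h'] at h
  exact h

/-- The energy of charges smeared at distances `ε i` is nonnegative. -/
lemma regularized_energy_nonneg (q σ θ ε : ι → ℝ) (hε : ∀ i, 0 < ε i) :
    0 ≤ ∑ i, ∑ j, q i * q j * -Real.log (gap (|σ i - σ j| + (ε i + ε j)) (θ i - θ j)) := by
  have h : HasSum (fun n : ℕ => ∑ i, ∑ j, q i * q j *
      (Real.exp (-(n * Real.pi * (|σ i - σ j| + (ε i + ε j)))) *
        Real.cos (n * Real.pi * (θ i - θ j)) / n))
      (∑ i, ∑ j, q i * q j * -Real.log (gap (|σ i - σ j| + (ε i + ε j)) (θ i - θ j))) :=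
    hasSum_sum fun i _ => hasSum_sum fun j _ => (hasSum_neg_log_gap
      (add_pos_of_nonneg_of_pos (abs_nonneg _) (add_pos (hε i) (hε j))) _).mul_left _
  refine h.nonneg fun n => ?_
  have hn : 0 ≤ n * Real.pi := mul_nonneg n.cast_nonneg Real.pi_pos.le
  have h1 := sum_mul_exp_neg_abs_nonneg
    (fun i => q i * Real.exp (-(n * Real.pi * ε i)) * Real.cos (n * Real.pi * θ i)) σ hn
  have h2 := sum_mul_exp_neg_abs_nonneg
    (fun i => q i * Real.exp (-(n * Real.pi * ε i)) * Real.sin (n * Real.pi * θ i)) σ hn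
  refine (div_nonneg (add_nonneg h1 h2) n.cast_nonneg).trans_eq ?_
  simp only [← Finset.sum_add_distrib, Finset.sum_div]
  refine Finset.sum_congr rfl fun i _ => Finset.sum_congr rfl fun j _ => ?_
  have h3 : Real.exp (-(n * Real.pi * (|σ i - σ j| + (ε i + ε j)))) =
      Real.exp (-(n * Real.pi * |σ i - σ j|)) * Real.exp (-(n * Real.pi * ε i)) *
        Real.exp (-(n * Real.pi * ε j)) := by
    rw [← Real.exp_add, ← Real.exp_add]; ring_nf
  rw [h3, mul_sub, Real.cos_sub]
  ring

/-- Onsager's lower bound on the interaction energy, in terms of lower bounds `r i` on the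
distances from the `i`-th charge to all others. -/
lemma sum_mul_log_gap_le [DecidableEq ι] (q σ θ r : ι → ℝ) (hr : ∀ i, 0 < r i)
    (hr' : ∀ i j, i ≠ j → r i ≤ gap |σ i - σ j| (θ i - θ j)) (hr1 : ∀ i, r i ≤ 1) :
    ∑ i, ∑ j, (if i = j then 0 else q i * q j * Real.log (gap |σ i - σ j| (θ i - θ j))) ≤
      Real.log 3 * ∑ i, ∑ j, |q i * q j| + ∑ i, q i ^ 2 * -Real.log (r i / 3) := by
  have hπ := Real.pi_pos
  have h := regularized_energy_nonneg q σ θ (fun i => r i / Real.pi)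
    fun i => div_pos (hr i) hπ
  have key : ∀ i j, (if i = j then 0 else q i * q j * Real.log (gap |σ i - σ j| (θ i - θ j))) +
      q i * q j * -Real.log (gap (|σ i - σ j| + (r i / Real.pi + r j / Real.pi)) (θ i - θ j)) ≤
      Real.log 3 * |q i * q j| + if i = j then q i ^ 2 * -Real.log (r i / 3) else 0 := by
    intro i j
    have hδ : 0 < r i / Real.pi + r j / Real.pi :=
      add_pos (div_pos (hr i) hπ) (div_pos (hr j) hπ)
    have hl3 : 0 ≤ Real.log 3 := Real.log_nonneg (by norm_num)
    by_cases hij : i = j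
    · subst hij
      simp only [if_true, zero_add, sub_self, abs_zero]
      have h1 : r i / 3 ≤ gap (r i / Real.pi + r i / Real.pi) 0 := by
        refine le_trans ?_ (one_sub_exp_le_gap _ _)
        have h2 : Real.pi * (r i / Real.pi + r i / Real.pi) = 2 * r i := by field_simp; ring
        rw [h2]
        have h3 : Real.exp (-(2 * r i)) * (1 + 2 * r i) ≤ 1 := by
          rw [Real.exp_neg, inv_mul_le_iff₀ (Real.exp_pos _), mul_one, add_comm]
          exact Real.add_one_le_exp _
        have h4 := hr1 i
        have h5 := hr i
        nlinarith [Real.exp_pos (-(2 * r i))]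
      have h2 := Real.log_le_log (div_pos (hr i) (by norm_num)) h1
      have h3 : 0 ≤ Real.log 3 * |q i * q i| := by positivity
      have h4 : q i * q i * -Real.log (gap (r i / Real.pi + r i / Real.pi) 0) ≤
          q i ^ 2 * -Real.log (r i / 3) := by
        rw [← sq]; gcongr
      linarith
    · simp only [if_neg hij, add_zero]
      have hd := hr' i j hij
      have hd' := hr' j i (Ne.symm hij)
      rw [abs_sub_comm, ← neg_sub (θ i), gap_neg_right] at hd'
      have hg : 0 < gap |σ i - σ j| (θ i - θ j) := (hr i).trans_le hd
      have h1 := gap_le_two_mul_gap_add (abs_nonneg (σ i - σ j)) hδ.le (θ i - θ j)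
      have h2 := gap_add_le (abs_nonneg (σ i - σ j)) hδ.le (θ i - θ j)
      have h3 : Real.pi * (r i / Real.pi + r j / Real.pi) = r i + r j := by field_simp
      rw [h3] at h2
      set g := gap |σ i - σ j| (θ i - θ j)
      set g' := gap (|σ i - σ j| + (r i / Real.pi + r j / Real.pi)) (θ i - θ j)
      have hg' : 0 < g' := by linarith
      have h4 : Real.log g ≤ Real.log 3 + Real.log g' := by
        rw [← Real.log_mul (by norm_num) hg'.ne']
        exact Real.log_le_log hg (by linarith)
      have h5 : Real.log g' ≤ Real.log 3 + Real.log g := by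
        rw [← Real.log_mul (by norm_num) hg.ne']
        exact Real.log_le_log hg' (by linarith)
      calc q i * q j * Real.log g + q i * q j * -Real.log g'
          = q i * q j * (Real.log g - Real.log g') := by ring
        _ ≤ |q i * q j| * |Real.log g - Real.log g'| := by
            rw [← abs_mul]; exact le_abs_self _
        _ ≤ |q i * q j| * Real.log 3 := by
            gcongr; exact abs_le.2 ⟨by linarith, by linarith⟩
        _ = _ := mul_comm _ _
  have h1 := Finset.sum_le_sum fun i (_ : i ∈ Finset.univ) =>
    Finset.sum_le_sum fun j (_ : j ∈ Finset.univ) => key i j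
  simp only [Finset.sum_add_distrib, ← Finset.mul_sum, Finset.sum_ite_eq, Finset.mem_univ,
    if_true] at h1
  linarith

end Energy

/-! ### Pointwise bounds on the integrand -/

/-- The reciprocal chord, infinite where the chord vanishes. -/
def invChord (θ : ℝ) : ENNReal := (ENNReal.ofReal (chord θ))⁻¹

section Crowd

variable {ι : Type*} [Fintype ι] [DecidableEq ι]

/-- One plus the sum of the reciprocal chords from the `i`-th point to all others. -/
def crowd (θ : ι → ℝ) (i : ι) : ENNReal := 1 + ∑ j ∈ Finset.univ.erase i, invChord (θ i - θ j)

/-- The product of the powers `crowd θ i ^ s`. -/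
def crowding (s : ℝ) (θ : ι → ℝ) : ENNReal := ∏ i, crowd θ i ^ s

lemma one_le_crowd (θ : ι → ℝ) (i : ι) : 1 ≤ crowd θ i := le_self_add

lemma one_le_crowd_rpow {s : ℝ} (hs : 0 < s) (θ : ι → ℝ) (i : ι) : 1 ≤ crowd θ i ^ s :=
  ENNReal.one_le_rpow (one_le_crowd θ i) hs

lemma crowding_eq_top {s : ℝ} (hs : 0 < s) {θ : ι → ℝ} {i j : ι} (hij : i ≠ j)
    (h : chord (θ i - θ j) = 0) : crowding s θ = ⊤ := by
  have h1 : crowd θ i = ⊤ := by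
    rw [crowd, ← Finset.add_sum_erase _ _ (Finset.mem_erase.2 ⟨hij.symm, Finset.mem_univ j⟩),
      invChord, h]
    simp
  rw [crowding, ← Finset.mul_prod_erase _ _ (Finset.mem_univ i), h1, ENNReal.top_rpow_of_pos hs]
  refine ENNReal.top_mul (Finset.prod_ne_zero_iff.2 fun l _ => ?_)
  exact (zero_lt_one.trans_le (one_le_crowd_rpow hs θ l)).ne'

/-- The Boltzmann factor of one chirality is bounded by the crowding of the points. -/
lemma exp_sum_log_gap_le (n : ι → ℝ) {β s : ℝ} (hβ : 0 ≤ β) (hs : 0 < s)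
    (hn : ∀ i, β * n i ^ 2 ≤ s) : ∃ C : ENNReal, C ≠ ⊤ ∧ ∀ σ θ Θ : ι → ℝ,
      (∀ i j, chord (Θ i - Θ j) ≤ 5 * gap |σ i - σ j| (θ i - θ j)) →
      ENNReal.ofReal (Real.exp (β * ∑ i, ∑ j,
        (if i = j then 0 else n i * n j * Real.log (gap |σ i - σ j| (θ i - θ j))))) ≤
      C * crowding s Θ := by
  set K := Real.exp (β * (Real.log 3 * ∑ i, ∑ j, |n i * n j|)) with hK
  have hK0 : 0 < K := Real.exp_pos _
  refine ⟨ENNReal.ofReal (K * ∏ _i : ι, (15 : ℝ) ^ s), ENNReal.ofReal_ne_top, ?_⟩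
  intro σ θ Θ hΘ
  by_cases h0 : ∃ i j, i ≠ j ∧ chord (Θ i - Θ j) = 0
  · obtain ⟨i, j, hij, h⟩ := h0
    rw [crowding_eq_top hs hij h, ENNReal.mul_top]
    · exact le_top
    · exact (ENNReal.ofReal_pos.2 (by positivity)).ne'
  push Not at h0
  have hpos : ∀ i j, i ≠ j → 0 < chord (Θ i - Θ j) :=
    fun i j hij => (chord_nonneg _).lt_of_ne (h0 i j hij).symm
  set ρ : ι → ℝ := fun i => 1 + ∑ j ∈ Finset.univ.erase i, (chord (Θ i - Θ j))⁻¹ with hρ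
  have hnn : ∀ i, ∀ j ∈ Finset.univ.erase i, 0 ≤ (chord (Θ i - Θ j))⁻¹ :=
    fun i j _ => inv_nonneg.2 (chord_nonneg _)
  have hρ1 : ∀ i, 1 ≤ ρ i := fun i => le_add_of_nonneg_right (Finset.sum_nonneg (hnn i))
  have hcrowd : ∀ i, crowd Θ i = ENNReal.ofReal (ρ i) := by
    intro i
    rw [hρ, crowd, ENNReal.ofReal_add zero_le_one (Finset.sum_nonneg (hnn i)), ENNReal.ofReal_one,
      ENNReal.ofReal_sum_of_nonneg (hnn i)]
    congr 1
    refine Finset.sum_congr rfl fun j hj => ?_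
    rw [invChord, ENNReal.ofReal_inv_of_pos (hpos i j (Finset.ne_of_mem_erase hj).symm)]
  have hr : ∀ i j, i ≠ j → (5 * ρ i)⁻¹ ≤ gap |σ i - σ j| (θ i - θ j) := by
    intro i j hij
    have h1 : (chord (Θ i - Θ j))⁻¹ ≤ ρ i :=
      (Finset.single_le_sum (hnn i) (Finset.mem_erase.2 ⟨hij.symm, Finset.mem_univ j⟩)).trans
        (le_add_of_nonneg_left zero_le_one)
    have h2 := inv_anti₀ (inv_pos.2 (hpos i j hij)) h1
    rw [inv_inv] at h2
    have h3 := hΘ i j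
    rw [mul_inv]
    linarith
  have hons := sum_mul_log_gap_le n σ θ (fun i => (5 * ρ i)⁻¹)
    (fun i => inv_pos.2 (by linarith [hρ1 i])) hr
    (fun i => inv_le_one_of_one_le₀ (by linarith [hρ1 i]))
  have hlog : ∀ i, -Real.log ((5 * ρ i)⁻¹ / 3) = Real.log (15 * ρ i) := by
    intro i
    rw [← Real.log_inv]; congr 1
    have := hρ1 i
    field_simp; norm_num
  simp only [hlog] at hons
  have hmain : Real.exp (β * ∑ i, ∑ j,
      (if i = j then 0 else n i * n j * Real.log (gap |σ i - σ j| (θ i - θ j)))) ≤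
      K * (∏ _i : ι, (15 : ℝ) ^ s) * ∏ i, ρ i ^ s := by
    rw [mul_assoc, ← Finset.prod_mul_distrib]
    have h1 : ∀ i, (15 : ℝ) ^ s * ρ i ^ s = Real.exp (s * Real.log (15 * ρ i)) := by
      intro i
      have := hρ1 i
      rw [← Real.mul_rpow (by norm_num) (by linarith), Real.rpow_def_of_pos (by linarith),
        mul_comm]
    rw [Finset.prod_congr rfl fun i _ => h1 i, ← Real.exp_sum, hK, ← Real.exp_add]
    refine Real.exp_le_exp.2 ((mul_le_mul_of_nonneg_left hons hβ).trans ?_)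
    rw [mul_add, Finset.mul_sum (Finset.univ) _ β]
    refine add_le_add le_rfl (Finset.sum_le_sum fun i _ => ?_)
    rw [← mul_assoc]
    exact mul_le_mul_of_nonneg_right (hn i) (Real.log_nonneg (by linarith [hρ1 i]))
  refine (ENNReal.ofReal_le_ofReal hmain).trans_eq ?_
  rw [ENNReal.ofReal_mul (by positivity), crowding,
    ENNReal.ofReal_prod_of_nonneg fun i _ => Real.rpow_nonneg (by linarith [hρ1 i]) _]
  congr 1
  refine Finset.prod_congr rfl fun i _ => ?_
  rw [hcrowd, ENNReal.ofReal_rpow_of_pos (by linarith [hρ1 i])]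

end Crowd

/-! ### Sums over pairs -/

lemma sum_sum_ite_eq_two_mul_Ioi {m : ℕ} (e : Fin m → Fin m → ℝ) (he : ∀ i j, e i j = e j i) :
    ∑ i, ∑ j, (if i = j then 0 else e i j) = 2 * ∑ i, ∑ j ∈ Finset.Ioi i, e i j := by
  have h1 : ∀ i, ∑ j, (if i = j then 0 else e i j) =
      ∑ j ∈ Finset.Ioi i, e i j + ∑ j ∈ Finset.Iio i, e i j := by
    intro i
    rw [← Finset.sum_filter_add_sum_filter_not Finset.univ (fun j => i < j)]
    congr 1
    · rw [Finset.filter_lt_eq_Ioi]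
      exact Finset.sum_congr rfl fun j hj => if_neg (Finset.mem_Ioi.1 hj).ne
    · rw [← Finset.sum_subset (s₁ := Finset.Iio i)]
      · exact Finset.sum_congr rfl fun j hj => if_neg (Finset.mem_Iio.1 hj).ne'
      · intro j hj
        simpa using (Finset.mem_Iio.1 hj).le
      · intro j hj hj'
        simp only [Finset.mem_filter, Finset.mem_univ, true_and, not_lt, Finset.mem_Iio] at hj hj'
        exact if_pos (le_antisymm hj' hj)
  have h2 : ∑ i, ∑ j ∈ Finset.Iio i, e i j = ∑ i, ∑ j ∈ Finset.Ioi i, e i j := by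
    rw [Finset.sum_comm' (t' := Finset.univ) (s' := fun j => Finset.Ioi j) (by simp)]
    exact Finset.sum_congr rfl fun i _ => Finset.sum_congr rfl fun j _ => he _ _
  rw [Finset.sum_congr rfl fun i _ => h1 i, Finset.sum_add_distrib, h2, two_mul]

lemma sum_sum_sum_type {m w : ℕ} (e : Fin m ⊕ Fin w → Fin m ⊕ Fin w → ℝ)
    (he : ∀ i j, e i j = e j i) :
    ∑ i, ∑ j, (if i = j then 0 else e i j) =
      2 * ∑ i, ∑ j ∈ Finset.Ioi i, e (.inl i) (.inl j) +
      2 * ∑ i, ∑ l, e (.inl i) (.inr l) +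
      2 * ∑ l, ∑ l' ∈ Finset.Ioi l, e (.inr l) (.inr l') := by
  rw [← sum_sum_ite_eq_two_mul_Ioi (fun i j => e (.inl i) (.inl j)) fun _ _ => he _ _,
    ← sum_sum_ite_eq_two_mul_Ioi (fun i j => e (.inr i) (.inr j)) fun _ _ => he _ _]
  simp only [Fintype.sum_sum_type, Finset.sum_add_distrib, Sum.inl.injEq, Sum.inr.injEq, reduceCtorEq,
    if_false]
  rw [Finset.sum_comm (f := fun (l : Fin w) (i : Fin m) => e (.inr l) (.inl i))]
  simp only [he (.inr _) (.inl _)]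
  ring

/-- Neutrality makes the long-distance growth of the pair interactions decay. -/
lemma sum_abs_sub_le {m w : ℕ} (n : Fin m → ℝ) (hn : ∑ j, n j = -w) (σ : Fin w → ℝ) :
    2 * ∑ j, ∑ l, n j * |σ l| +
      2 * ∑ l, ∑ l' ∈ Finset.Ioi l, |σ l - σ l'| ≤ -2 * ∑ l, |σ l| := by
  rw [← sum_sum_ite_eq_two_mul_Ioi (fun l l' => |σ l - σ l'|) fun _ _ => abs_sub_comm _ _,
    ← Finset.sum_mul_sum, hn]
  have h : ∑ l, ∑ l', (if l = l' then 0 else |σ l - σ l'|) ≤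
      ∑ l, ∑ l', ((|σ l| + |σ l'|) - if l = l' then 2 * |σ l| else 0) := by
    refine Finset.sum_le_sum fun l _ => Finset.sum_le_sum fun l' _ => ?_
    split_ifs with h
    · subst h; linarith
    · rw [sub_zero]; exact abs_sub _ _
  simp only [Finset.sum_sub_distrib, Finset.sum_add_distrib, Finset.sum_const, Finset.card_univ,
    Fintype.card_fin, nsmul_eq_mul, Finset.sum_ite_eq, Finset.mem_univ, if_true,
    ← Finset.mul_sum] at h
  linarith

/-! ### The integrand in unrolled light-cone coordinates -/

/-- The contour unrolled to the real time axis by turning its horizontal parts. -/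
def unroll {k : ℕ} (t : Fin (k + 1) → ℝ) (s : ℝ) : ℝ := (contour t s).re + (contour t s).im

/-- Light-cone coordinates. -/
def lightCone (p : ℝ × ℝ) : ℝ × ℝ := (p.1 - p.2, p.1 + p.2)

/-- The light-cone coordinates of a marked point after unrolling the contour. -/
def unrolledCone {k : ℕ} (t : Fin (k + 1) → ℝ) (p : ℝ × ℝ) : ℝ × ℝ := lightCone (unroll t p.1, p.2)

/-- The decay of the integrand along the horizontal parts times the speed of the contour. -/
def screeningWeight {k : ℕ} (b : ℝ) (t : Fin (k + 1) → ℝ) (p : ℝ × ℝ) : ENNReal :=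
  ENNReal.ofReal (Real.exp (-(2 * Real.pi * b ^ 2 * |(contour t p.1).re|))) *
    ‖deriv (contour t) p.1‖ₑ

lemma unrolledCone_insertion {k : ℕ} (v : Fin (k + 1) → ℝ × ℝ) (j : Fin (k + 1)) :
    unrolledCone (fun i => (v i).1) (insertion v j) = lightCone (v j) := by
  simp [unrolledCone, insertion, unroll, contour_re_natCast, contour_im_natCast]

section Bounds

variable {k w : ℕ} (b : ℝ) (n : Fin (k + 1) → ℤ)

lemma re_external_exponent (v : Fin (k + 1) → ℝ × ℝ) :
    (-4 * ∑ j, ∑ j' ∈ Finset.Ioi j, charges b n j * charges b n j' *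
        orderedGreen (fun i => (v i).1) (insertion v j) (insertion v j')).re =
      -4 * b ^ 2 * ∑ j, ∑ j' ∈ Finset.Ioi j, (n j : ℝ) * n j' *
        (orderedGreen (fun i => (v i).1) (insertion v j) (insertion v j')).re := by
  have h : ∀ (j j' : Fin (k + 1)) (z : ℂ), charges b n j * charges b n j' * z =
      ((b ^ 2 * (n j * n j' : ℝ) : ℝ) : ℂ) * z := by
    intro j j' z; simp only [charges]; push_cast; ring
  rw [show (-4 : ℂ) = ((-4 : ℝ) : ℂ) by push_cast; rfl]
  simp only [h, Complex.re_ofReal_mul, Complex.re_sum, Finset.mul_sum]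
  refine Finset.sum_congr rfl fun j _ => Finset.sum_congr rfl fun j' _ => ?_
  ring

lemma re_screening_exponent (v : Fin (k + 1) → ℝ × ℝ) (u : Fin w → ℝ × ℝ) :
    (-4 * b * ∑ j, ∑ l, charges b n j * orderedGreen (fun i => (v i).1) (insertion v j) (u l)
        - 4 * b ^ 2 * ∑ l, ∑ l' ∈ Finset.Ioi l,
          orderedGreen (fun i => (v i).1) (u l) (u l') : ℂ).re =
      -4 * b ^ 2 * (∑ j, ∑ l, (n j : ℝ) *
          (orderedGreen (fun i => (v i).1) (insertion v j) (u l)).re +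
        ∑ l, ∑ l' ∈ Finset.Ioi l, (orderedGreen (fun i => (v i).1) (u l) (u l')).re) := by
  have h : ∀ (j : Fin (k + 1)) (z : ℂ), charges b n j * z = ((b * (n j : ℝ) : ℝ) : ℂ) * z := by
    intro j z; simp only [charges]; push_cast; rfl
  rw [show (-4 * b : ℂ) = ((-4 * b : ℝ) : ℂ) by push_cast; rfl,
    show (4 * b ^ 2 : ℂ) = ((4 * b ^ 2 : ℝ) : ℂ) by push_cast; rfl]
  simp only [h, Complex.sub_re, Complex.re_ofReal_mul, Complex.re_sum, mul_add, Finset.mul_sum]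
  rw [sub_eq_add_neg, ← Finset.sum_neg_distrib]
  congr 1
  · refine Finset.sum_congr rfl fun j _ => Finset.sum_congr rfl fun j' _ => ?_
    ring
  · refine Finset.sum_congr rfl fun j _ => ?_
    rw [← Finset.sum_neg_distrib]
    refine Finset.sum_congr rfl fun j' _ => ?_
    ring

lemma enorm_prod_deriv (t : Fin (k + 1) → ℝ) (u : Fin w → ℝ × ℝ) :
    ‖∏ l, deriv (contour t) (u l).1‖ₑ = ∏ l, ‖deriv (contour t) (u l).1‖ₑ := by
  simp only [← ofReal_norm, norm_prod]
  exact ENNReal.ofReal_prod_of_nonneg fun _ _ => norm_nonneg _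

lemma enorm_exp (z : ℂ) : ‖Complex.exp z‖ₑ = ENNReal.ofReal (Real.exp z.re) := by
  rw [← ofReal_norm, Complex.norm_exp]

lemma prod_screeningWeight (t : Fin (k + 1) → ℝ) (u : Fin w → ℝ × ℝ) :
    ∏ l, screeningWeight b t (u l) =
      ENNReal.ofReal (Real.exp (-(2 * Real.pi * b ^ 2 * ∑ l, |(contour t (u l).1).re|))) *
        ‖∏ l, deriv (contour t) (u l).1‖ₑ := by
  simp only [screeningWeight]
  rw [Finset.prod_mul_distrib, enorm_prod_deriv,
    ← ENNReal.ofReal_prod_of_nonneg fun _ _ => (Real.exp_pos _).le, ← Real.exp_sum,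
    Finset.sum_neg_distrib, Finset.mul_sum]

lemma chord_unroll_le (t : Fin (k + 1) → ℝ) (s s' c : ℝ) :
    chord ((unroll t s - unroll t s') + c) ≤
      5 * gap |(contour t s).re - (contour t s').re|
        (((contour t s).im - (contour t s').im) + c) := by
  have h := chord_add_le_gap (le_refl |(contour t s).re - (contour t s').re|)
    (((contour t s).im - (contour t s').im) + c)
  refine le_trans (le_of_eq ?_) h
  rw [unroll, unroll]; congr 1; ring

/-- The charged Boltzmann factor of all insertions is bounded by the decay along the contour and
the crowding in both light-cone coordinates. -/
lemma enorm_integrand_le (hn : ∑ j, n j = -(w : ℤ)) {s : ℝ} (hs : 0 < s)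
    (hns : ∀ j, b ^ 2 * (n j : ℝ) ^ 2 ≤ s) (hbs : b ^ 2 ≤ s) :
    ∃ C : ENNReal, C ≠ ⊤ ∧ ∀ (v : Fin (k + 1) → ℝ × ℝ) (u : Fin w → ℝ × ℝ),
      ‖Complex.exp (-4 * ∑ j, ∑ j' ∈ Finset.Ioi j, charges b n j * charges b n j' *
          orderedGreen (fun i => (v i).1) (insertion v j) (insertion v j'))‖ₑ *
        ‖screeningIntegrand b w (charges b n) v u‖ₑ ≤
      C * ((∏ l, screeningWeight b (fun i => (v i).1) (u l)) *
        (crowding s (Sum.elim (fun j => (lightCone (v j)).1)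
            fun l => (unrolledCone (fun i => (v i).1) (u l)).1) *
          crowding s (Sum.elim (fun j => (lightCone (v j)).2)
            fun l => (unrolledCone (fun i => (v i).1) (u l)).2))) := by
  set N : Fin (k + 1) ⊕ Fin w → ℝ := Sum.elim (fun j => (n j : ℝ)) fun _ => 1 with hN
  obtain ⟨C, hC, hbound⟩ := exp_sum_log_gap_le N (sq_nonneg b) hs (by
    rintro (j | l)
    · exact hns j
    · simpa [hN] using hbs)
  refine ⟨C * C, ENNReal.mul_ne_top hC hC, fun v u => ?_⟩
  set t : Fin (k + 1) → ℝ := fun i => (v i).1 with ht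
  set P : Fin (k + 1) ⊕ Fin w → ℝ × ℝ := Sum.elim (insertion v) u with hP
  set σ : Fin (k + 1) ⊕ Fin w → ℝ := fun i => (contour t (P i).1).re with hσ
  set θ₁ : Fin (k + 1) ⊕ Fin w → ℝ := fun i => (contour t (P i).1).im - (P i).2 with hθ₁
  set θ₂ : Fin (k + 1) ⊕ Fin w → ℝ := fun i => (contour t (P i).1).im + (P i).2 with hθ₂
  have hcone : ∀ i, Sum.elim (fun j => lightCone (v j)) (fun l => unrolledCone t (u l)) i =
      unrolledCone t (P i) := by
    rintro (j | l)
    · exact (unrolledCone_insertion v j).symm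
    · rfl
  have hcone₁ : (Sum.elim (fun j => (lightCone (v j)).1) fun l => (unrolledCone t (u l)).1) =
      fun i => (unrolledCone t (P i)).1 := by
    funext i; rw [← hcone]; cases i <;> rfl
  have hcone₂ : (Sum.elim (fun j => (lightCone (v j)).2) fun l => (unrolledCone t (u l)).2) =
      fun i => (unrolledCone t (P i)).2 := by
    funext i; rw [← hcone]; cases i <;> rfl
  have hb₁ := hbound σ θ₁ (fun i => (unrolledCone t (P i)).1) (fun i j => by
    have := chord_unroll_le t (P i).1 (P j).1 ((P j).2 - (P i).2)
    simp only [unrolledCone, lightCone, hσ, hθ₁]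
    convert this using 3 <;> ring)
  have hb₂ := hbound σ θ₂ (fun i => (unrolledCone t (P i)).2) (fun i j => by
    have := chord_unroll_le t (P i).1 (P j).1 ((P i).2 - (P j).2)
    simp only [unrolledCone, lightCone, hσ, hθ₂]
    convert this using 3 <;> ring)
  set S₁ := ∑ i, ∑ j, (if i = j then 0 else N i * N j * Real.log (gap |σ i - σ j| (θ₁ i - θ₁ j)))
    with hS₁
  set S₂ := ∑ i, ∑ j, (if i = j then 0 else N i * N j * Real.log (gap |σ i - σ j| (θ₂ i - θ₂ j)))
    with hS₂
  have hpair := sum_sum_sum_type (fun i j => N i * N j * (orderedGreen t (P i) (P j)).re)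
    fun i j => by rw [orderedGreen_comm]; ring
  have hsplit : -2 * ∑ i, ∑ j, (if i = j then 0 else N i * N j * (orderedGreen t (P i) (P j)).re) =
      Real.pi * (∑ i, ∑ j, (if i = j then 0 else N i * N j * |σ i - σ j|)) + S₁ + S₂ := by
    rw [hS₁, hS₂, Finset.mul_sum, Finset.mul_sum, ← Finset.sum_add_distrib,
      ← Finset.sum_add_distrib]
    refine Finset.sum_congr rfl fun i _ => ?_
    rw [Finset.mul_sum, Finset.mul_sum, ← Finset.sum_add_distrib, ← Finset.sum_add_distrib]
    refine Finset.sum_congr rfl fun j _ => ?_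
    split_ifs
    · simp
    · rw [orderedGreen_re]; ring
  have hgrowth := sum_sum_sum_type (fun i j => N i * N j * |σ i - σ j|)
    fun i j => by rw [abs_sub_comm]; ring
  have hσl : ∀ j, σ (.inl j) = 0 := fun j => contour_re_natCast t j
  have hσr : ∀ l, σ (.inr l) = (contour t (u l).1).re := fun l => rfl
  simp only [hσl, hσr, sub_self, abs_zero, mul_zero, Finset.sum_const_zero, zero_add, zero_sub,
    abs_neg, hN, Sum.elim_inl, Sum.elim_inr, mul_one, one_mul] at hgrowth
  have hdecay := sum_abs_sub_le (fun j => (n j : ℝ)) (by exact_mod_cast hn)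
    fun l => (contour t (u l).1).re
  rw [← hgrowth] at hdecay
  have hexp : (-4 * ∑ j, ∑ j' ∈ Finset.Ioi j, charges b n j * charges b n j' *
          orderedGreen t (insertion v j) (insertion v j')).re +
      (-4 * b * ∑ j, ∑ l, charges b n j * orderedGreen t (insertion v j) (u l)
        - 4 * b ^ 2 * ∑ l, ∑ l' ∈ Finset.Ioi l, orderedGreen t (u l) (u l') : ℂ).re ≤
      -(2 * Real.pi * b ^ 2 * ∑ l, |(contour t (u l).1).re|) + b ^ 2 * S₁ + b ^ 2 * S₂ := by
    rw [re_external_exponent, re_screening_exponent]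
    simp only [hN, hP, Sum.elim_inl, Sum.elim_inr, mul_one, one_mul] at hpair
    have h1 : 0 ≤ b ^ 2 * Real.pi := by positivity
    have h2 := mul_le_mul_of_nonneg_left hdecay h1
    calc _ = b ^ 2 * (-2 * ∑ i, ∑ j,
          (if i = j then 0 else N i * N j * (orderedGreen t (P i) (P j)).re)) := by
          simp only [hN, hP]; rw [hpair]; ring
      _ = b ^ 2 * Real.pi * (∑ i, ∑ j, (if i = j then 0 else N i * N j * |σ i - σ j|)) +
          b ^ 2 * S₁ + b ^ 2 * S₂ := by rw [hsplit]; ring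
      _ ≤ _ := by linarith
  rw [hcone₁, hcone₂, prod_screeningWeight, screeningIntegrand, enorm_mul, enorm_exp, enorm_exp,
    ← mul_assoc, ← ENNReal.ofReal_mul (Real.exp_pos _).le, ← Real.exp_add]
  calc _ ≤ ENNReal.ofReal (Real.exp (-(2 * Real.pi * b ^ 2 * ∑ l, |(contour t (u l).1).re|)
          + b ^ 2 * S₁ + b ^ 2 * S₂)) * ‖∏ l, deriv (contour t) (u l).1‖ₑ := by
        gcongr
    _ = ENNReal.ofReal (Real.exp (-(2 * Real.pi * b ^ 2 * ∑ l, |(contour t (u l).1).re|))) *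
          ‖∏ l, deriv (contour t) (u l).1‖ₑ *
          (ENNReal.ofReal (Real.exp (b ^ 2 * S₁)) * ENNReal.ofReal (Real.exp (b ^ 2 * S₂))) := by
        rw [Real.exp_add, Real.exp_add, ENNReal.ofReal_mul (by positivity),
          ENNReal.ofReal_mul (by positivity)]
        ring
    _ ≤ _ * ((C * _) * (C * _)) := by gcongr
    _ = _ := by ring

end Bounds

/-! ### Bounds at fixed, separated insertions -/

lemma log_gap_le_log_two {σ : ℝ} (hσ : 0 ≤ σ) (θ : ℝ) : Real.log (gap σ θ) ≤ Real.log 2 := by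
  rcases (gap_nonneg σ θ).eq_or_lt with h | h
  · rw [← h, Real.log_zero]; exact Real.log_nonneg one_le_two
  · exact Real.log_le_log h (gap_le_two hσ θ)

lemma exp_mul_log_gap_le {a c σ θ Θ : ℝ} (ha : 0 < a) (hc : |c| ≤ a) (hσ : 0 ≤ σ)
    (h : chord Θ ≤ 5 * gap σ θ) :
    ENNReal.ofReal (Real.exp (c * Real.log (gap σ θ))) ≤
      ENNReal.ofReal (Real.exp (a * Real.log 20)) * invChord Θ ^ a := by
  rcases (chord_nonneg Θ).eq_or_lt with h0 | h0
  · rw [invChord, ← h0, ENNReal.ofReal_zero, ENNReal.inv_zero, ENNReal.top_rpow_of_pos ha,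
      ENNReal.mul_top (ENNReal.ofReal_pos.2 (Real.exp_pos _)).ne']
    exact le_top
  · have hg : 0 < gap σ θ := by linarith
    have h1 := log_gap_le_log_two hσ θ
    have h2 : Real.log (chord Θ) ≤ Real.log 5 + Real.log (gap σ θ) := by
      rw [← Real.log_mul (by norm_num) hg.ne']
      exact Real.log_le_log h0 h
    have h20 : Real.log 20 = Real.log 5 + 2 * Real.log 2 := by
      rw [show (20 : ℝ) = 5 * (2 * 2) by norm_num, Real.log_mul (by norm_num) (by norm_num),
        Real.log_mul (by norm_num) (by norm_num), two_mul]
    have hl2 : 0 ≤ Real.log 2 := Real.log_nonneg one_le_two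
    have h3 : c * Real.log (gap σ θ) ≤ a * Real.log 20 + Real.log (chord Θ) * -a := by
      calc c * Real.log (gap σ θ) ≤ |c| * |Real.log (gap σ θ)| := by
            rw [← abs_mul]; exact le_abs_self _
        _ ≤ a * |Real.log (gap σ θ)| := by gcongr
        _ ≤ a * (Real.log 20 - Real.log (chord Θ)) := by
            gcongr
            exact abs_le.2 ⟨by linarith, by linarith⟩
        _ = _ := by ring
    rw [invChord, ← ENNReal.ofReal_inv_of_pos h0, ENNReal.ofReal_rpow_of_pos (inv_pos.2 h0),
      ← ENNReal.ofReal_mul (Real.exp_pos _).le, Real.inv_rpow h0.le, ← Real.rpow_neg h0.le,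
      Real.rpow_def_of_pos h0, ← Real.exp_add]
    exact ENNReal.ofReal_le_ofReal (Real.exp_le_exp.2 h3)

lemma prod_le_mul_sum {ι : Type*} [Fintype ι] [DecidableEq ι] [Nonempty ι] (D : ι → ENNReal)
    (M : ENNReal) (h : ∀ i j, i ≠ j → D i ≤ M ∨ D j ≤ M) :
    ∏ i, D i ≤ M ^ (Fintype.card ι - 1) * ∑ i, D i := by
  obtain ⟨i, hi⟩ : ∃ i, ∀ j, j ≠ i → D j ≤ M := by
    by_cases h' : ∃ i, M < D i
    · obtain ⟨i, hi⟩ := h'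
      exact ⟨i, fun j hj => (h j i hj).resolve_right hi.not_ge⟩
    · push Not at h'
      exact ⟨Classical.arbitrary ι, fun j _ => h' j⟩
  rw [← Finset.mul_prod_erase _ _ (Finset.mem_univ i), mul_comm]
  refine mul_le_mul' ?_ (Finset.single_le_sum (fun _ _ => zero_le) (Finset.mem_univ i))
  refine (Finset.prod_le_pow_card _ _ M fun j hj => hi j (Finset.ne_of_mem_erase hj)).trans_eq ?_
  rw [Finset.card_erase_of_mem (Finset.mem_univ i), Finset.card_univ]

lemma prod_exp_mul_log_gap_le {ι : Type*} [Fintype ι] [Nonempty ι] (c Θ' : ι → ℝ)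
    {a : ℝ} (ha : 0 < a) (hc : ∀ i, |c i| ≤ a) (hΘ' : ∀ i j, i ≠ j → 0 < chord (Θ' i - Θ' j)) :
    ∃ C : ENNReal, C ≠ ⊤ ∧ ∀ (Θ : ℝ) (σ θ : ι → ℝ), (∀ i, 0 ≤ σ i) →
      (∀ i, chord (Θ - Θ' i) ≤ 5 * gap (σ i) (θ i)) →
      ENNReal.ofReal (Real.exp (∑ i, c i * Real.log (gap (σ i) (θ i)))) ≤
        C * ∑ i, invChord (Θ - Θ' i) ^ a := by
  classical
  obtain ⟨δ, hδ, hδ'⟩ : ∃ δ : ℝ, 0 < δ ∧ ∀ i j, i ≠ j → δ ≤ chord (Θ' i - Θ' j) := by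
    have h : ∀ᶠ δ in nhdsWithin (0 : ℝ) (Set.Ioi 0), ∀ i j, i ≠ j → δ ≤ chord (Θ' i - Θ' j) := by
      refine Filter.eventually_all.2 fun i => Filter.eventually_all.2 fun j => ?_
      by_cases hij : i = j
      · exact Filter.Eventually.of_forall fun _ h => (h hij).elim
      · filter_upwards [Ioo_mem_nhdsGT (hΘ' i j hij)] with δ hδ _ using hδ.2.le
    obtain ⟨δ, h1, h2⟩ := (h.and self_mem_nhdsWithin).exists
    exact ⟨δ, h2, h1⟩
  set M : ENNReal := (ENNReal.ofReal (δ / 2))⁻¹ ^ a with hM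
  have hMtop : M ≠ ⊤ := ENNReal.rpow_ne_top_of_nonneg ha.le
    (ENNReal.inv_ne_top.2 (ENNReal.ofReal_pos.2 (half_pos hδ)).ne')
  set K : ENNReal := ENNReal.ofReal (Real.exp (a * Real.log 20)) with hK
  refine ⟨(∏ _i : ι, K) * M ^ (Fintype.card ι - 1), ?_, fun Θ σ θ hσ h => ?_⟩
  · refine ENNReal.mul_ne_top (ENNReal.prod_ne_top fun _ _ => ENNReal.ofReal_ne_top)
      (ENNReal.pow_ne_top hMtop)
  · rw [Real.exp_sum, ENNReal.ofReal_prod_of_nonneg fun _ _ => (Real.exp_pos _).le, mul_assoc]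
    calc _ ≤ ∏ i, (K * invChord (Θ - Θ' i) ^ a) :=
          Finset.prod_le_prod' fun i _ => exp_mul_log_gap_le ha (hc i) (hσ i) (h i)
      _ = (∏ _i : ι, K) * ∏ i, invChord (Θ - Θ' i) ^ a := Finset.prod_mul_distrib
      _ ≤ _ := by
          gcongr
          refine prod_le_mul_sum _ _ fun i j hij => ?_
          have key : ∀ x : ℝ, δ / 2 ≤ chord x → invChord x ^ a ≤ M := fun x hx => by
            rw [hM, invChord]; gcongr
          have h1 := chord_add_le (-(Θ - Θ' i)) (Θ - Θ' j)
          rw [chord_neg, show -(Θ - Θ' i) + (Θ - Θ' j) = Θ' i - Θ' j by ring] at h1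
          have h2 := hδ' i j hij
          rcases le_total (δ / 2) (chord (Θ - Θ' i)) with h3 | h3
          · exact Or.inl (key _ h3)
          · exact Or.inr (key _ (by linarith))

section Bounds

variable {k w : ℕ} (b : ℝ) (n : Fin (k + 1) → ℤ)

/-- At fixed separated insertions the integrand is dominated by a product of functions of the
individual screening points. -/
lemma enorm_screeningIntegrand_le (hn : ∑ j, n j = -(w : ℤ)) {a : ℝ} (ha : 0 < a)
    (hna : ∀ j, |2 * b ^ 2 * (n j : ℝ)| ≤ a) (v : Fin (k + 1) → ℝ × ℝ) (hv : NonLightCone v) :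
    ∃ C : ENNReal, C ≠ ⊤ ∧ ∀ u : Fin w → ℝ × ℝ,
      ‖screeningIntegrand b w (charges b n) v u‖ₑ ≤
      C * ∏ l, (screeningWeight b (fun i => (v i).1) (u l) *
        ((∑ j, invChord ((unrolledCone (fun i => (v i).1) (u l)).1 - (lightCone (v j)).1) ^ a) *
          ∑ j, invChord ((unrolledCone (fun i => (v i).1) (u l)).2 - (lightCone (v j)).2) ^ a)) := by
  set t : Fin (k + 1) → ℝ := fun i => (v i).1 with ht
  have hsep₁ : ∀ i j, i ≠ j → 0 < chord ((lightCone (v i)).1 - (lightCone (v j)).1) := by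
    intro i j hij
    rcases lt_or_gt_of_ne hij with h | h
    · refine chord_pos fun m hm => (hv i j h m).2 (hm ▸ ?_)
      simp only [lightCone]; ring
    · rw [← chord_neg]
      refine chord_pos fun m hm => (hv j i h m).2 (hm ▸ ?_)
      simp only [lightCone]; ring
  have hsep₂ : ∀ i j, i ≠ j → 0 < chord ((lightCone (v i)).2 - (lightCone (v j)).2) := by
    intro i j hij
    rcases lt_or_gt_of_ne hij with h | h
    · refine chord_pos fun m hm => (hv i j h m).1 (hm ▸ ?_)
      simp only [lightCone]; ring
    · rw [← chord_neg]
      refine chord_pos fun m hm => (hv j i h m).1 (hm ▸ ?_)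
      simp only [lightCone]; ring
  obtain ⟨C₁, hC₁, h₁⟩ := prod_exp_mul_log_gap_le (fun j => 2 * b ^ 2 * (n j : ℝ))
    (fun j => (lightCone (v j)).1) ha hna hsep₁
  obtain ⟨C₂, hC₂, h₂⟩ := prod_exp_mul_log_gap_le (fun j => 2 * b ^ 2 * (n j : ℝ))
    (fun j => (lightCone (v j)).2) ha hna hsep₂
  set K : ℝ := ∑ l : Fin w, ∑ _l' ∈ Finset.Ioi l, 4 * b ^ 2 * Real.log 2 with hK
  refine ⟨ENNReal.ofReal (Real.exp K) * ∏ _l : Fin w, (C₁ * C₂), ?_, fun u => ?_⟩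
  · exact ENNReal.mul_ne_top ENNReal.ofReal_ne_top
      (ENNReal.prod_ne_top fun _ _ => ENNReal.mul_ne_top hC₁ hC₂)
  set σ : Fin (k + 1) → Fin w → ℝ := fun j l =>
    |(contour t (insertion v j).1).re - (contour t (u l).1).re| with hσ
  set θ₁ : Fin (k + 1) → Fin w → ℝ := fun j l => ((contour t (insertion v j).1).im -
    (insertion v j).2) - ((contour t (u l).1).im - (u l).2) with hθ₁
  set θ₂ : Fin (k + 1) → Fin w → ℝ := fun j l => ((contour t (insertion v j).1).im +
    (insertion v j).2) - ((contour t (u l).1).im + (u l).2) with hθ₂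
  set S₁ : Fin w → ℝ := fun l => ∑ j, 2 * b ^ 2 * (n j : ℝ) * Real.log (gap (σ j l) (θ₁ j l))
    with hS₁
  set S₂ : Fin w → ℝ := fun l => ∑ j, 2 * b ^ 2 * (n j : ℝ) * Real.log (gap (σ j l) (θ₂ j l))
    with hS₂
  have hdecay := sum_abs_sub_le (fun j => (n j : ℝ)) (by exact_mod_cast hn)
    fun l => (contour t (u l).1).re
  have hext : -4 * b ^ 2 * ∑ j, ∑ l, (n j : ℝ) * (orderedGreen t (insertion v j) (u l)).re =
      2 * Real.pi * b ^ 2 * (∑ j, ∑ l, (n j : ℝ) * |(contour t (u l).1).re|) +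
        ∑ l, S₁ l + ∑ l, S₂ l := by
    simp only [hS₁, hS₂]
    rw [Finset.sum_comm (f := fun (l : Fin w) (j : Fin (k + 1)) =>
        2 * b ^ 2 * (n j : ℝ) * Real.log (gap (σ j l) (θ₁ j l))),
      Finset.sum_comm (f := fun (l : Fin w) (j : Fin (k + 1)) =>
        2 * b ^ 2 * (n j : ℝ) * Real.log (gap (σ j l) (θ₂ j l)))]
    simp only [Finset.mul_sum, ← Finset.sum_add_distrib]
    refine Finset.sum_congr rfl fun j _ => Finset.sum_congr rfl fun l _ => ?_
    rw [orderedGreen_re]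
    have h0 : (contour t (insertion v j).1).re = 0 := contour_re_natCast t j
    simp only [hσ, hθ₁, hθ₂]
    rw [h0, zero_sub, abs_neg]
    ring
  have hint : -4 * b ^ 2 * ∑ l, ∑ l' ∈ Finset.Ioi l, (orderedGreen t (u l) (u l')).re ≤
      2 * Real.pi * b ^ 2 *
        (∑ l, ∑ l' ∈ Finset.Ioi l, |(contour t (u l).1).re - (contour t (u l').1).re|) + K := by
    simp only [hK, Finset.mul_sum, ← Finset.sum_add_distrib]
    refine Finset.sum_le_sum fun l _ => Finset.sum_le_sum fun l' _ => ?_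
    rw [orderedGreen_re]
    have hb2 := sq_nonneg b
    have e1 := mul_le_mul_of_nonneg_left (log_gap_le_log_two
      (abs_nonneg ((contour t (u l).1).re - (contour t (u l').1).re))
      (((contour t (u l).1).im - (u l).2) - ((contour t (u l').1).im - (u l').2))) hb2
    have e2 := mul_le_mul_of_nonneg_left (log_gap_le_log_two
      (abs_nonneg ((contour t (u l).1).re - (contour t (u l').1).re))
      (((contour t (u l).1).im + (u l).2) - ((contour t (u l').1).im + (u l').2))) hb2
    linarith
  have hexp : (-4 * b * ∑ j, ∑ l, charges b n j * orderedGreen t (insertion v j) (u l)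
        - 4 * b ^ 2 * ∑ l, ∑ l' ∈ Finset.Ioi l, orderedGreen t (u l) (u l') : ℂ).re ≤
      K + -(2 * Real.pi * b ^ 2 * ∑ l, |(contour t (u l).1).re|) + (∑ l, S₁ l + ∑ l, S₂ l) := by
    rw [re_screening_exponent]
    have h1 : 0 ≤ b ^ 2 * Real.pi := by positivity
    have h2 := mul_le_mul_of_nonneg_left hdecay h1
    linarith
  rw [screeningIntegrand, enorm_mul, enorm_exp]
  simp only [Finset.prod_mul_distrib]
  rw [prod_screeningWeight]
  have hb₁ : ∀ l, ENNReal.ofReal (Real.exp (S₁ l)) ≤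
      C₁ * ∑ j, invChord ((unrolledCone t (u l)).1 - (lightCone (v j)).1) ^ a := fun l =>
    h₁ _ (fun j => σ j l) (fun j => θ₁ j l) (fun j => abs_nonneg _) fun j => by
      have := chord_unroll_le t (insertion v j).1 (u l).1 ((u l).2 - (insertion v j).2)
      rw [← unrolledCone_insertion, ← neg_sub, chord_neg]
      simp only [unrolledCone, lightCone, hσ, hθ₁]
      convert this using 3 <;> ring
  have hb₂ : ∀ l, ENNReal.ofReal (Real.exp (S₂ l)) ≤
      C₂ * ∑ j, invChord ((unrolledCone t (u l)).2 - (lightCone (v j)).2) ^ a := fun l =>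
    h₂ _ (fun j => σ j l) (fun j => θ₂ j l) (fun j => abs_nonneg _) fun j => by
      have := chord_unroll_le t (insertion v j).1 (u l).1 ((insertion v j).2 - (u l).2)
      rw [← unrolledCone_insertion, ← neg_sub, chord_neg]
      simp only [unrolledCone, lightCone, hσ, hθ₂]
      convert this using 3 <;> ring
  calc _ ≤ ENNReal.ofReal (Real.exp (K + -(2 * Real.pi * b ^ 2 * ∑ l, |(contour t (u l).1).re|) +
          (∑ l, S₁ l + ∑ l, S₂ l))) * ‖∏ l, deriv (contour t) (u l).1‖ₑ := by
        gcongr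
    _ = ENNReal.ofReal (Real.exp K) *
          (ENNReal.ofReal (Real.exp (-(2 * Real.pi * b ^ 2 * ∑ l, |(contour t (u l).1).re|))) *
            ‖∏ l, deriv (contour t) (u l).1‖ₑ) *
          ∏ l, (ENNReal.ofReal (Real.exp (S₁ l)) * ENNReal.ofReal (Real.exp (S₂ l))) := by
        have e : ∀ S : Fin w → ℝ, ∏ l, ENNReal.ofReal (Real.exp (S l)) =
            ENNReal.ofReal (Real.exp (∑ l, S l)) := fun S => by
          rw [Real.exp_sum, ENNReal.ofReal_prod_of_nonneg fun _ _ => (Real.exp_pos _).le]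
        rw [Finset.prod_mul_distrib, e, e, Real.exp_add, Real.exp_add, Real.exp_add,
          ENNReal.ofReal_mul (by positivity), ENNReal.ofReal_mul (by positivity),
          ENNReal.ofReal_mul (by positivity)]
        ring
    _ ≤ _ * _ * ∏ l, ((C₁ * _) * (C₂ * _)) := by
        gcongr with l
        · exact hb₁ l
        · exact hb₂ l
    _ = _ := by
        simp only [Finset.prod_mul_distrib]
        ring

end Bounds

/-! ### Integrability of powers of the reciprocal chord -/

@[fun_prop]
lemma measurable_invChord : Measurable invChord := by unfold invChord; fun_prop

lemma invChord_neg (θ : ℝ) : invChord (-θ) = invChord θ := by rw [invChord, chord_neg, invChord]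

lemma setLIntegral_Ioc_zero_one_invChord_rpow_lt_top {p : ℝ} (hp : 0 ≤ p) (hp1 : p < 1) :
    ∫⁻ y in Set.Ioc 0 1, invChord y ^ p < ⊤ := by
  have h := (intervalIntegral.intervalIntegrable_rpow' (a := 0) (b := 1)
    (neg_lt_neg hp1)).1.hasFiniteIntegral
  refine lt_of_le_of_lt (setLIntegral_mono (by fun_prop) fun y hy => ?_) h
  rw [← ofReal_norm, Real.norm_of_nonneg (Real.rpow_nonneg hy.1.le _), Real.rpow_neg hy.1.le,
    ← Real.inv_rpow hy.1.le, ← ENNReal.ofReal_rpow_of_pos (inv_pos.2 hy.1),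
    ENNReal.ofReal_inv_of_pos hy.1, invChord]
  have hy' := two_mul_abs_le_chord (θ := y) (by rw [abs_of_pos hy.1]; exact hy.2)
  rw [abs_of_pos hy.1] at hy'
  gcongr
  linarith [hy.1]

lemma setLIntegral_Ioc_invChord_rpow_lt_top {p : ℝ} (hp : 0 ≤ p) (hp1 : p < 1) :
    ∫⁻ y in Set.Ioc (-1) 1, invChord y ^ p < ⊤ := by
  have h := setLIntegral_Ioc_zero_one_invChord_rpow_lt_top hp hp1
  rw [← Set.Ioc_union_Ioc_eq_Ioc (b := (0 : ℝ)) (by norm_num) (by norm_num)]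
  refine (lintegral_union_le _ _ _).trans_lt (ENNReal.add_lt_top.2 ⟨?_, h⟩)
  rw [← restrict_Ioo_eq_restrict_Ioc] at h ⊢
  have h' := (Measure.measurePreserving_neg (volume : Measure ℝ)).setLIntegral_comp_preimage
    (measurableSet_Ioo (a := (0 : ℝ)) (b := 1)) (f := fun y => invChord y ^ p) (by fun_prop)
  simp only [invChord_neg] at h'
  have hpre : (Neg.neg : ℝ → ℝ) ⁻¹' Set.Ioo 0 1 = Set.Ioo (-1) 0 := by
    simp [Set.neg_preimage]
  rw [hpre] at h'
  rwa [h']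

lemma setLIntegral_Ioc_invChord_rpow_sub (p a t : ℝ) :
    ∫⁻ y in Set.Ioc t (t + 2), invChord (y - a) ^ p = ∫⁻ y in Set.Ioc (-1) 1, invChord y ^ p := by
  have hper : Function.Periodic (fun y => invChord y ^ p) 2 := fun y => by
    simp only [invChord]; rw [chord_periodic]
  have h' := (measurePreserving_sub_right (volume : Measure ℝ) a).setLIntegral_comp_preimage
    (measurableSet_Ioc (a := t - a) (b := t - a + 2)) (f := fun y => invChord y ^ p) (by fun_prop)
  rw [show (fun y : ℝ => y - a) ⁻¹' Set.Ioc (t - a) (t - a + 2) = Set.Ioc t (t + 2) by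
    ext; simp; intro _; constructor <;> intro <;> linarith] at h'
  rw [h']
  have : VAddInvariantMeasure (AddSubgroup.zmultiples (2 : ℝ)) ℝ volume :=
    ⟨fun c s _ => measure_preimage_add _ _ _⟩
  have h2 := IsAddFundamentalDomain.setLIntegral_eq (G := AddSubgroup.zmultiples (2 : ℝ))
    (isAddFundamentalDomain_Ioc two_pos (t - a)) (isAddFundamentalDomain_Ioc two_pos (-1))
    (fun y => invChord y ^ p) hper.map_vadd_zmultiples
  rw [h2]
  norm_num

/-- The measure with density `e^{-c|y|}` on the line. -/
def lineMeasure (c : ℝ) : Measure ℝ :=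
  volume.withDensity fun y => ENNReal.ofReal (Real.exp (-(c * |y|)))

lemma summable_exp_neg_mul_abs_int {c : ℝ} (hc : 0 < c) :
    Summable fun m : ℤ => Real.exp (-(c * |(m : ℝ)|)) := by
  have h : Summable fun m : ℕ => Real.exp (-(c * m)) := by
    simpa [mul_comm] using Real.summable_exp_nat_mul_iff.2 (neg_lt_zero.2 hc)
  refine Summable.of_nat_of_neg ?_ ?_ <;> simpa using h

lemma lintegral_invChord_rpow_sub_le {c p : ℝ} (hc : 0 < c) (hp : 0 ≤ p) (hp1 : p < 1) :
    ∃ C : ENNReal, C ≠ ⊤ ∧ ∀ a : ℝ, ∫⁻ y, invChord (y - a) ^ p ∂(lineMeasure c) ≤ C := by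
  set J := ∫⁻ y in Set.Ioc (-1) 1, invChord y ^ p with hJ
  have hJtop : J < ⊤ := setLIntegral_Ioc_invChord_rpow_lt_top hp hp1
  set S := ∑' m : ℤ, ENNReal.ofReal (Real.exp (2 * c) * Real.exp (-(2 * c * |(m : ℝ)|))) with hS
  have hStop : S ≠ ⊤ :=
    ((summable_exp_neg_mul_abs_int (mul_pos two_pos hc)).mul_left _).tsum_ofReal_ne_top
  refine ⟨S * J, ENNReal.mul_ne_top hStop hJtop.ne, fun a => ?_⟩
  rw [lineMeasure, lintegral_withDensity_eq_lintegral_mul _ (by fun_prop) (by fun_prop),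
    ← setLIntegral_univ, ← iUnion_Ioc_zsmul (two_pos : (0 : ℝ) < 2)]
  refine (lintegral_iUnion_le _ _).trans ?_
  rw [hS, ← ENNReal.tsum_mul_right]
  refine ENNReal.tsum_le_tsum fun m => ?_
  have hm : (m + 1) • (2 : ℝ) = m • 2 + 2 := by rw [add_smul, one_smul]
  rw [hm, hJ, ← setLIntegral_Ioc_invChord_rpow_sub p a (m • 2),
    ← lintegral_const_mul _ (by fun_prop)]
  refine setLIntegral_mono (by fun_prop) fun y hy => ?_
  simp only [Pi.mul_apply]
  gcongr
  rw [← Real.exp_add]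
  refine Real.exp_le_exp.2 ?_
  simp only [zsmul_eq_mul] at hy
  have h1 : 2 * |(m : ℝ)| ≤ |y| + 2 := by
    rcases abs_cases (m : ℝ) with h | h <;> rcases abs_cases y with h' | h' <;>
      linarith [hy.1, hy.2]
  nlinarith

instance (c : ℝ) : SigmaFinite (lineMeasure c) := by unfold lineMeasure; infer_instance

lemma lineMeasure_univ_ne_top {c : ℝ} (hc : 0 < c) : lineMeasure c Set.univ ≠ ⊤ := by
  obtain ⟨C, hC, h⟩ := lintegral_invChord_rpow_sub_le hc le_rfl zero_lt_one
  have := h 0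
  simp only [ENNReal.rpow_zero, lintegral_one] at this
  exact ne_top_of_le_ne_top hC this

/-! ### Integrability of the crowding -/

lemma lintegral_prod_one_add_sum_invChord_ne_top {c p : ℝ} (hc : 0 < c) (hp : 0 ≤ p)
    (hp1 : p < 1) (N : ℕ) :
    ∫⁻ θ : Fin N → ℝ, ∏ i, (1 + ∑ j ∈ Finset.Ioi i, invChord (θ i - θ j) ^ p)
      ∂(Measure.pi fun _ => lineMeasure c) ≠ ⊤ := by
  obtain ⟨C, hC, hbound⟩ := lintegral_invChord_rpow_sub_le hc hp hp1
  induction N with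
  | zero => simp
  | succ N ih =>
    have hmp := (measurePreserving_piFinSuccAbove (fun _ : Fin (N + 1) => lineMeasure c) 0).symm
    rw [← hmp.lintegral_comp_emb (MeasurableEquiv.measurableEmbedding _)]
    have hcons : ∀ y : ℝ × (Fin N → ℝ),
        ∏ i, (1 + ∑ j ∈ Finset.Ioi i,
          invChord ((MeasurableEquiv.piFinSuccAbove (fun _ : Fin (N + 1) => ℝ) 0).symm y i -
            (MeasurableEquiv.piFinSuccAbove (fun _ : Fin (N + 1) => ℝ) 0).symm y j) ^ p) =
        (1 + ∑ j, invChord (y.1 - y.2 j) ^ p) *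
          ∏ i, (1 + ∑ j ∈ Finset.Ioi i, invChord (y.2 i - y.2 j) ^ p) := by
      rintro ⟨x, θ⟩
      have e : (MeasurableEquiv.piFinSuccAbove (fun _ : Fin (N + 1) => ℝ) 0).symm (x, θ) =
          (Fin.cons x θ : Fin (N + 1) → ℝ) := by
        simp [MeasurableEquiv.piFinSuccAbove, Fin.insertNthEquiv]
      rw [e, Fin.prod_univ_succ]
      simp only [Fin.cons_zero, Fin.cons_succ, Fin.Ioi_zero_eq_map, Fin.Ioi_succ, Finset.sum_map,
        Fin.coe_succEmb]
    simp only [hcons]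
    rw [lintegral_prod_symm _ (by fun_prop)]
    refine ne_top_of_le_ne_top (ENNReal.mul_ne_top (a := lineMeasure c Set.univ + N * C)
      (ENNReal.add_ne_top.2 ⟨lineMeasure_univ_ne_top hc,
        ENNReal.mul_ne_top (ENNReal.natCast_ne_top N) hC⟩) ih) ?_
    rw [← lintegral_const_mul _ (by fun_prop)]
    refine lintegral_mono fun θ => ?_
    dsimp only
    rw [lintegral_mul_const _ (by fun_prop), lintegral_add_left measurable_const,
      lintegral_finsetSum _ (by fun_prop)]
    gcongr
    · simp
    · refine (Finset.sum_le_sum fun j _ => hbound (θ j)).trans ?_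
      simp

lemma one_add_sum_rpow_le {ι : Type*} (S : Finset ι) (f : ι → ENNReal) {p : ℝ} (hp : 0 < p)
    (hp1 : p ≤ 1) : (1 + ∑ i ∈ S, f i) ^ p ≤ 1 + ∑ i ∈ S, f i ^ p := by
  refine (ENNReal.rpow_add_le_add_rpow _ _ hp.le hp1).trans ?_
  rw [ENNReal.one_rpow]
  gcongr
  exact Finset.le_sum_of_subadditive (fun x : ENNReal => x ^ p) (ENNReal.zero_rpow_of_pos hp).le
    (fun x y => ENNReal.rpow_add_le_add_rpow x y hp.le hp1) S f

lemma crowding_le {N : ℕ} {s : ℝ} (hs : 0 < s) (hs1 : 2 * s ≤ 1) (θ : Fin N → ℝ) :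
    crowding s θ ≤ ∏ i, (1 + ∑ j ∈ Finset.Ioi i, invChord (θ i - θ j) ^ (2 * s)) +
      ∏ i, (1 + ∑ j ∈ Finset.Iio i, invChord (θ i - θ j) ^ (2 * s)) := by
  set A : Fin N → ENNReal := fun i => 1 + ∑ j ∈ Finset.Ioi i, invChord (θ i - θ j) with hA
  set B : Fin N → ENNReal := fun i => 1 + ∑ j ∈ Finset.Iio i, invChord (θ i - θ j) with hB
  have h0 : ∀ x y : ENNReal, 1 + (x + y) ≤ (1 + x) * (1 + y) := fun x y =>
    (le_self_add (b := x * y)).trans_eq (by ring)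
  have h1 : ∀ i, crowd θ i ≤ A i * B i := by
    intro i
    have hu : Finset.univ.erase i = Finset.Ioi i ∪ Finset.Iio i := by
      ext j; simp [lt_or_lt_iff_ne, eq_comm]
    rw [crowd, hu, Finset.sum_union (by
      rw [Finset.disjoint_left]; intro j hj hj'
      exact (Finset.mem_Ioi.1 hj).not_gt (Finset.mem_Iio.1 hj')), hA, hB]
    exact h0 _ _
  have h2 : ∀ x y : ENNReal, x * y ≤ x ^ 2 + y ^ 2 := fun x y => by
    rcases le_total x y with h | h
    · exact (mul_le_mul_left h y).trans ((sq y).symm.le.trans le_add_self)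
    · exact (mul_le_mul_right h x).trans ((sq x).symm.le.trans le_self_add)
  have h3 : ∀ x : ENNReal, (x ^ s) ^ 2 = x ^ (2 * s) := fun x => by
    rw [← ENNReal.rpow_natCast, ← ENNReal.rpow_mul, mul_comm]; norm_num
  calc crowding s θ ≤ ∏ i, (A i * B i) ^ s :=
        Finset.prod_le_prod' fun i _ => ENNReal.rpow_le_rpow (h1 i) hs.le
    _ = (∏ i, A i ^ s) * ∏ i, B i ^ s := by
        rw [← Finset.prod_mul_distrib]
        exact Finset.prod_congr rfl fun i _ => ENNReal.mul_rpow_of_nonneg _ _ hs.le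
    _ ≤ (∏ i, A i ^ s) ^ 2 + (∏ i, B i ^ s) ^ 2 := h2 _ _
    _ = ∏ i, A i ^ (2 * s) + ∏ i, B i ^ (2 * s) := by
        simp only [← Finset.prod_pow, h3]
    _ ≤ _ := by
        gcongr with i _ i _
        · exact one_add_sum_rpow_le _ _ (by linarith) hs1
        · exact one_add_sum_rpow_le _ _ (by linarith) hs1

lemma measurePreserving_comp_equiv {ι ι' X : Type*} [Fintype ι] [Fintype ι'] [MeasurableSpace X]
    (ν : Measure X) [SigmaFinite ν] (e : ι ≃ ι') :
    MeasurePreserving (fun θ : ι → X => θ ∘ e.symm) (Measure.pi fun _ => ν)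
      (Measure.pi fun _ => ν) :=
  measurePreserving_arrowCongr' (fun _ : ι => ν) (fun _ : ι' => ν) e (MeasurableEquiv.refl X)
    fun _ => MeasurePreserving.id ν

@[fun_prop]
lemma measurable_crowding {ι : Type*} [Fintype ι] [DecidableEq ι] (s : ℝ) :
    Measurable (crowding (ι := ι) s) := by
  unfold crowding crowd; fun_prop

/-- The Coulomb gas on the circle is integrable as long as all charges are subcritical. -/
lemma lintegral_crowding_ne_top {ι : Type*} [Fintype ι] [DecidableEq ι] {c s : ℝ} (hc : 0 < c)
    (hs : 0 < s) (hs1 : 2 * s < 1) :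
    ∫⁻ θ : ι → ℝ, crowding s θ ∂(Measure.pi fun _ => lineMeasure c) ≠ ⊤ := by
  let e := Fintype.equivFin ι
  have h0 : ∀ θ : Fin (Fintype.card ι) → ℝ, crowding s (θ ∘ e) = crowding s θ := by
    intro θ
    rw [crowding, crowding, ← e.prod_comp]
    refine Finset.prod_congr rfl fun i _ => ?_
    rw [crowd, crowd]
    congr 2
    refine Finset.sum_nbij' e e.symm ?_ ?_ ?_ ?_ ?_ <;> simp [Equiv.symm_apply_eq]
  have h1 := (measurePreserving_comp_equiv (lineMeasure c) e.symm).lintegral_comp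
    (measurable_crowding (ι := ι) s)
  rw [← h1]
  simp only [Equiv.symm_symm, h0]
  have hmain := lintegral_prod_one_add_sum_invChord_ne_top hc (by linarith : 0 ≤ 2 * s) hs1
    (Fintype.card ι)
  refine ne_top_of_le_ne_top (ENNReal.add_ne_top.2 ⟨hmain, hmain⟩)
    ((lintegral_mono fun θ => crowding_le hs hs1.le θ).trans ?_)
  rw [lintegral_add_left (by fun_prop)]
  refine add_le_add le_rfl ?_
  have h2 := (measurePreserving_comp_equiv (lineMeasure c)
    (Fin.revPerm (n := Fintype.card ι))).lintegral_comp
    (f := fun θ => ∏ i, (1 + ∑ j ∈ Finset.Ioi i, invChord (θ i - θ j) ^ (2 * s))) (by fun_prop)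
  rw [← h2]
  refine le_of_eq (lintegral_congr fun θ => ?_)
  rw [← Equiv.prod_comp Fin.revPerm]
  refine Finset.prod_congr rfl fun i _ => ?_
  congr 1
  refine Finset.sum_nbij' Fin.rev Fin.rev ?_ ?_ ?_ ?_ ?_ <;>
    simp [Fin.lt_rev_iff]

/-! ### Changes of variables as inequalities -/

lemma lintegral_pi_comp_le {X Y : Type*} [MeasurableSpace X] [MeasurableSpace Y] {ν : Measure X}
    [SigmaFinite ν] {ν' : Measure Y} [SigmaFinite ν'] {a : X → ENNReal} (ha : Measurable a)
    {φ : X → Y} (hφ : Measurable φ) {C : ENNReal}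
    (h : ∀ g : Y → ENNReal, Measurable g → ∫⁻ p, a p * g (φ p) ∂ν ≤ C * ∫⁻ y, g y ∂ν') (n : ℕ)
    (H : (Fin n → Y) → ENNReal) (hH : Measurable H) :
    ∫⁻ u, (∏ l, a (u l)) * H (fun l => φ (u l)) ∂(Measure.pi fun _ : Fin n => ν) ≤
      C ^ n * ∫⁻ y, H y ∂(Measure.pi fun _ : Fin n => ν') := by
  induction n with
  | zero =>
    rw [pow_zero, one_mul, Measure.pi_of_empty, Measure.pi_of_empty, lintegral_dirac' _ hH,
      lintegral_dirac' _ (by fun_prop)]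
    simp only [Finset.univ_eq_empty, Finset.prod_empty, one_mul]
    exact le_of_eq (congrArg H (Subsingleton.elim _ _))
  | succ n ih =>
    set e := (MeasurableEquiv.piFinSuccAbove (fun _ : Fin (n + 1) => Y) 0).symm with he
    have hmp := (measurePreserving_piFinSuccAbove (fun _ : Fin (n + 1) => ν) 0).symm
    have hmp' := (measurePreserving_piFinSuccAbove (fun _ : Fin (n + 1) => ν') 0).symm
    rw [← hmp.lintegral_comp_emb (MeasurableEquiv.measurableEmbedding _),
      ← hmp'.lintegral_comp_emb (MeasurableEquiv.measurableEmbedding _)]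
    have hcons : ∀ p : X × (Fin n → X),
        (∏ l, a ((MeasurableEquiv.piFinSuccAbove (fun _ : Fin (n + 1) => X) 0).symm p l)) *
          H (fun l => φ ((MeasurableEquiv.piFinSuccAbove (fun _ : Fin (n + 1) => X) 0).symm p l)) =
        (∏ l, a (p.2 l)) * (a p.1 * H (e (φ p.1, fun l => φ (p.2 l)))) := by
      rintro ⟨x, u⟩
      have e1 : (MeasurableEquiv.piFinSuccAbove (fun _ : Fin (n + 1) => X) 0).symm (x, u) =
          (Fin.cons x u : Fin (n + 1) → X) := by
        simp [MeasurableEquiv.piFinSuccAbove, Fin.insertNthEquiv]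
      have e2 : e (φ x, fun l => φ (u l)) =
          (Fin.cons (φ x) (fun l => φ (u l)) : Fin (n + 1) → Y) := by
        simp [he, MeasurableEquiv.piFinSuccAbove, Fin.insertNthEquiv]
      have e3 : (fun l => φ ((Fin.cons x u : Fin (n + 1) → X) l)) =
          (Fin.cons (φ x) (fun l => φ (u l)) : Fin (n + 1) → Y) := by
        funext l
        refine Fin.cases ?_ (fun l => ?_) l <;> simp
      rw [e1, e2, e3, Fin.prod_univ_succ]
      simp only [Fin.cons_zero, Fin.cons_succ]
      ring
    simp only [hcons]
    have hHe : Measurable fun q : Y × (Fin n → Y) => H (e q) := hH.comp e.measurable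
    have hm : Measurable fun p : X × (Fin n → X) => H (e (φ p.1, fun l => φ (p.2 l))) :=
      hHe.comp (by fun_prop)
    rw [lintegral_prod_symm _ (by fun_prop), lintegral_prod_symm _ hHe.aemeasurable, pow_succ,
      mul_assoc]
    calc ∫⁻ u : Fin n → X, ∫⁻ x, (∏ l, a (u l)) * (a x * H (e (φ x, fun l => φ (u l)))) ∂ν
          ∂(Measure.pi fun _ => ν)
        ≤ ∫⁻ u : Fin n → X, (∏ l, a (u l)) * (C * ∫⁻ y, H (e (y, fun l => φ (u l))) ∂ν')
            ∂(Measure.pi fun _ => ν) := by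
          refine lintegral_mono fun u => ?_
          dsimp only
          rw [lintegral_const_mul _ (show Measurable fun x => a x * H (e (φ x, fun l => φ (u l))) from
            ha.mul (hm.comp (by fun_prop : Measurable fun x : X => (x, u))))]
          gcongr
          exact h (fun y => H (e (y, fun l => φ (u l)))) (hHe.comp (by fun_prop))
      _ ≤ C ^ n * ∫⁻ z : Fin n → Y, C * ∫⁻ y, H (e (y, z)) ∂ν' ∂(Measure.pi fun _ => ν') :=
          ih (fun z => C * ∫⁻ y, H (e (y, z)) ∂ν')
            (Measurable.const_mul hHe.lintegral_prod_left' _)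
      _ = _ := by
          rw [lintegral_const_mul _ hHe.lintegral_prod_left']

lemma ofReal_abs_mul_lintegral_comp_affine_le (α β : ℝ) {h : ℝ → ENNReal} (hh : Measurable h) :
    ENNReal.ofReal |β| * ∫⁻ s, h (α + β * s) ≤ ∫⁻ y, h y := by
  rcases eq_or_ne β 0 with rfl | hβ
  · simp
  · have hm : Measurable fun y => h (α + y) := by fun_prop
    rw [← lintegral_add_left_eq_self h α]
    calc _ = ∫⁻ y, h (α + y) ∂(ENNReal.ofReal |β| • Measure.map (fun x => β * x) volume) := by
          rw [lintegral_smul_measure, lintegral_map hm (by fun_prop), smul_eq_mul]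
      _ ≤ _ := by rw [Real.smul_map_volume_mul_left hβ]

section Contour

variable {k : ℕ} (t : Fin (k + 1) → ℝ)

lemma setLIntegral_deriv_contour_le {U : Set ℝ} (hU : IsOpen U) (A B : ℂ)
    (hB : |B.re + B.im| = ‖B‖) (hc : ∀ s ∈ U, contour t s = A + s * B) {h : ℝ → ENNReal}
    (hh : Measurable h) :
    ∫⁻ s in U, ‖deriv (contour t) s‖ₑ * h (unroll t s) ≤ ∫⁻ y, h y := by
  refine le_trans ?_ (ofReal_abs_mul_lintegral_comp_affine_le (A.re + A.im) (B.re + B.im) hh)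
  rw [← lintegral_const_mul _ (by fun_prop)]
  refine le_trans (setLIntegral_mono' hU.measurableSet fun s hs => ?_) (setLIntegral_le_lintegral U _)
  have hd : deriv (contour t) s = B := by
    have h1 : contour t =ᶠ[nhds s] fun s : ℝ => A + (s : ℂ) * B :=
      Filter.eventuallyEq_of_mem (hU.mem_nhds hs) hc
    rw [h1.deriv_eq]
    have h2 : HasDerivAt (fun s : ℝ => A + (s : ℂ) * B) (1 * B) s :=
      ((Complex.ofRealCLM.hasDerivAt (x := s)).mul_const B).const_add A
    rw [h2.deriv, one_mul]
  have hu : unroll t s = (A.re + A.im) + (B.re + B.im) * s := by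
    rw [unroll, hc s hs]
    simp
    ring
  rw [hd, hu, hB, ofReal_norm]

lemma clamp_of_nonpos {x : ℝ} (h : x ≤ 0) : max 0 (min 1 x) = 0 :=
  max_eq_left ((min_le_right _ _).trans h)

lemma clamp_of_one_le {x : ℝ} (h : 1 ≤ x) : max 0 (min 1 x) = 1 := by
  rw [min_eq_left h, max_eq_right zero_le_one]

lemma contour_eq_of_neg {s : ℝ} (hs : s < 0) : contour t s = Complex.I * t 0 + s * 1 := by
  apply Complex.ext
  · rw [contour_re, min_eq_left hs.le, max_eq_right (by linarith [k.cast_nonneg (α := ℝ)])]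
    simp
  · rw [contour_im, Finset.sum_eq_zero]
    · simp
    · intro j _
      rw [clamp_of_nonpos (by linarith [(j : ℕ).cast_nonneg (α := ℝ)]), mul_zero]

lemma contour_eq_of_gt {s : ℝ} (hs : k < s) :
    contour t s = (-k + Complex.I * t (Fin.last k)) + s * 1 := by
  apply Complex.ext
  · rw [contour_re, min_eq_right (by linarith [k.cast_nonneg (α := ℝ)]),
      max_eq_left (by linarith)]
    simp; ring
  · have h : ∀ j : Fin k, (t j.succ - t j.castSucc) * max 0 (min 1 (s - (j : ℕ))) =
        t j.succ - t j.castSucc := fun j => by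
      have : ((j : ℕ) : ℝ) + 1 ≤ k := by exact_mod_cast j.2
      rw [clamp_of_one_le (by linarith), mul_one]
    rw [contour_im, Finset.sum_congr rfl fun j _ => h j, sum_contour_increments]
    simp

lemma contour_eq_of_mem_Ioo (j : Fin k) {s : ℝ} (hs : s ∈ Set.Ioo ((j : ℕ) : ℝ) ((j : ℕ) + 1)) :
    contour t s =
      (Complex.I * t j.castSucc - (j : ℕ) * (Complex.I * (t j.succ - t j.castSucc : ℝ))) +
        s * (Complex.I * (t j.succ - t j.castSucc : ℝ)) := by
  have hj0 := (j : ℕ).cast_nonneg (α := ℝ)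
  have hjk : ((j : ℕ) : ℝ) + 1 ≤ k := by exact_mod_cast j.2
  apply Complex.ext
  · rw [contour_re, min_eq_right (by linarith [hs.1]), max_eq_right (by linarith [hs.2])]
    simp
  · have h1 := contour_im_natCast t j.castSucc
    rw [contour_im] at h1
    have h2 : ∀ i : Fin k, (t i.succ - t i.castSucc) * max 0 (min 1 (s - (i : ℕ))) =
        (t i.succ - t i.castSucc) * max 0 (min 1 ((((j.castSucc : Fin (k + 1)) : ℕ) : ℝ) - ((i : ℕ) : ℝ))) +
          if i = j then (t j.succ - t j.castSucc) * (s - (j : ℕ)) else 0 := by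
      intro i
      rw [Fin.val_castSucc]
      rcases lt_trichotomy i j with h | h | h
      · have : ((i : ℕ) : ℝ) + 1 ≤ (j : ℕ) := by exact_mod_cast h
        rw [if_neg h.ne, clamp_of_one_le (by linarith [hs.1]), clamp_of_one_le (by linarith),
          add_zero]
      · subst h
        rw [if_pos rfl, sub_self, clamp_of_nonpos le_rfl, min_eq_right (by linarith [hs.2]),
          max_eq_right (by linarith [hs.1]), mul_zero, zero_add]
      · have : ((j : ℕ) : ℝ) + 1 ≤ (i : ℕ) := by exact_mod_cast h
        rw [if_neg h.ne', clamp_of_nonpos (by linarith [hs.2]), clamp_of_nonpos (by linarith),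
          add_zero]
    rw [contour_im, Finset.sum_congr rfl fun i _ => h2 i, Finset.sum_add_distrib,
      Finset.sum_ite_eq' Finset.univ j, if_pos (Finset.mem_univ j), ← add_assoc, h1]
    simp
    ring

/-- The contour is traversed with the speed of its unrolling, which meets each time at most once
on each of the `k + 2` straight pieces. -/
lemma lintegral_deriv_contour_le {h : ℝ → ENNReal} (hh : Measurable h) :
    ∫⁻ s, ‖deriv (contour t) s‖ₑ * h (unroll t s) ≤ (k + 2) * ∫⁻ y, h y := by
  set F : ℝ → ENNReal := fun s => ‖deriv (contour t) s‖ₑ * h (unroll t s) with hF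
  have hcover : (Set.univ : Set ℝ) ⊆ ((Set.Iio 0 ∪ Set.Ioi (k : ℝ)) ∪
      ⋃ j : Fin k, Set.Ioo ((j : ℕ) : ℝ) ((j : ℕ) + 1)) ∪
      Set.range fun j : Fin (k + 1) => ((j : ℕ) : ℝ) := by
    intro s _
    by_cases h0 : s < 0
    · exact Or.inl (Or.inl (Or.inl h0))
    by_cases hk : (k : ℝ) < s
    · exact Or.inl (Or.inl (Or.inr hk))
    push Not at h0 hk
    have h1 := Nat.floor_le h0
    have h2 := Nat.lt_floor_add_one s
    have h3 : ⌊s⌋₊ ≤ k := Nat.floor_le_of_le hk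
    rcases h1.eq_or_lt with h4 | h4
    · exact Or.inr ⟨⟨⌊s⌋₊, Nat.lt_succ_of_le h3⟩, h4⟩
    · have h5 : ⌊s⌋₊ < k := by exact_mod_cast h4.trans_le hk
      exact Or.inl (Or.inr (Set.mem_iUnion.2 ⟨⟨⌊s⌋₊, h5⟩, h4, h2⟩))
  have hzero : ∫⁻ s in Set.range fun j : Fin (k + 1) => ((j : ℕ) : ℝ), F s = 0 :=
    setLIntegral_measure_zero _ _ ((Set.finite_range _).measure_zero _)
  have hleft : ∫⁻ s in Set.Iio 0, F s ≤ ∫⁻ y, h y :=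
    setLIntegral_deriv_contour_le t isOpen_Iio _ 1 (by simp)
      (fun s hs => contour_eq_of_neg t hs) hh
  have hright : ∫⁻ s in Set.Ioi (k : ℝ), F s ≤ ∫⁻ y, h y :=
    setLIntegral_deriv_contour_le t isOpen_Ioi _ 1 (by simp)
      (fun s hs => contour_eq_of_gt t hs) hh
  have hmid : ∀ j : Fin k, ∫⁻ s in Set.Ioo ((j : ℕ) : ℝ) ((j : ℕ) + 1), F s ≤ ∫⁻ y, h y :=
    fun j => setLIntegral_deriv_contour_le t isOpen_Ioo _ _
      (by
        rw [norm_mul, Complex.norm_I, one_mul, Complex.norm_real, Complex.I_mul_re,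
          Complex.I_mul_im, Complex.ofReal_im, Complex.ofReal_re, neg_zero, zero_add,
          Real.norm_eq_abs])
      (fun s hs => contour_eq_of_mem_Ioo t j hs) hh
  calc ∫⁻ s, F s = ∫⁻ s in Set.univ, F s := (setLIntegral_univ F).symm
    _ ≤ _ := lintegral_mono_set hcover
    _ ≤ ((∫⁻ s in Set.Iio 0, F s) + ∫⁻ s in Set.Ioi (k : ℝ), F s) +
          (∫⁻ s in ⋃ j : Fin k, Set.Ioo ((j : ℕ) : ℝ) ((j : ℕ) + 1), F s) + 0 := by
        rw [← hzero]
        refine (lintegral_union_le _ _ _).trans (add_le_add ?_ le_rfl)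
        refine (lintegral_union_le _ _ _).trans (add_le_add ?_ le_rfl)
        exact lintegral_union_le _ _ _
    _ ≤ (∫⁻ y, h y) + (∫⁻ y, h y) + ∑ _j : Fin k, (∫⁻ y, h y) + 0 := by
        gcongr
        refine (lintegral_iUnion_le _ _).trans ?_
        rw [tsum_fintype]
        exact Finset.sum_le_sum fun j _ => hmid j
    _ = _ := by
        rw [Finset.sum_const, Finset.card_univ, Fintype.card_fin, nsmul_eq_mul]
        ring

lemma continuous_uncurry_contour :
    Continuous fun p : (Fin (k + 1) → ℝ) × ℝ => contour p.1 p.2 := by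
  unfold contour; fun_prop

@[fun_prop]
lemma continuous_unroll : Continuous (unroll t) := by
  unfold unroll; fun_prop

@[fun_prop]
lemma continuous_lightCone : Continuous lightCone := by unfold lightCone; fun_prop

@[fun_prop]
lemma continuous_unrolledCone : Continuous (unrolledCone t) := by
  unfold unrolledCone; fun_prop

lemma lintegral_lintegral_lightCone_le {h : ℝ × ℝ → ENNReal} (hh : Measurable h) :
    ∫⁻ x : ℝ, ∫⁻ τ : ℝ, h (lightCone (τ, x)) ≤ ∫⁻ y, h y := by
  calc ∫⁻ x : ℝ, ∫⁻ τ : ℝ, h (lightCone (τ, x))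
      = ∫⁻ x : ℝ, ∫⁻ τ : ℝ, h (τ, τ + 2 * x) := by
        refine lintegral_congr fun x => ?_
        rw [← lintegral_add_right_eq_self _ x]
        refine lintegral_congr fun τ => ?_
        simp only [lightCone]
        congr 2 <;> ring
    _ = ∫⁻ τ : ℝ, ∫⁻ x : ℝ, h (τ, τ + 2 * x) := lintegral_lintegral_swap (by fun_prop)
    _ ≤ ∫⁻ τ : ℝ, ∫⁻ y : ℝ, h (τ, y) := by
        refine lintegral_mono fun τ => ?_
        refine le_trans ?_ (ofReal_abs_mul_lintegral_comp_affine_le τ 2 (h := fun y => h (τ, y))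
          (by fun_prop))
        refine le_mul_of_one_le_left' ?_
        rw [ENNReal.one_le_ofReal, abs_of_pos two_pos]; exact one_le_two
    _ = ∫⁻ y, h y := by rw [Measure.volume_eq_prod, lintegral_prod _ hh.aemeasurable]

lemma lintegral_lineMeasure_prod (c : ℝ) {h : ℝ × ℝ → ENNReal} (hh : Measurable h) :
    ∫⁻ y, h y ∂((lineMeasure c).prod (lineMeasure c)) =
      ∫⁻ y : ℝ × ℝ, ENNReal.ofReal (Real.exp (-(c * |y.1|))) *
        ENNReal.ofReal (Real.exp (-(c * |y.2|))) * h y := by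
  rw [lineMeasure, prod_withDensity (by fun_prop) (by fun_prop),
    lintegral_withDensity_eq_lintegral_mul _ (by fun_prop) hh]
  rfl

lemma ae_cylinderMeasure_abs_le : ∀ᵐ p ∂cylinderMeasure, |p.2| ≤ 1 := by
  rw [cylinderMeasure]
  filter_upwards [ae_restrict_mem (MeasurableSet.univ.prod measurableSet_Icc)] with p hp
  exact abs_le.2 hp.2

/-- Integrals over the tube with the screening weight are bounded by integrals in light-cone
coordinates. -/
lemma lintegral_screeningWeight_le (b : ℝ) {R : ℝ} (hR : ∀ s, |(contour t s).im| ≤ R)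
    {h : ℝ × ℝ → ENNReal} (hh : Measurable h) :
    ∫⁻ p, screeningWeight b t p * h (unrolledCone t p) ∂cylinderMeasure ≤
      ENNReal.ofReal (Real.exp (2 * Real.pi * b ^ 2 * (R + 1))) * (k + 2) *
        ∫⁻ y, h y ∂((lineMeasure (Real.pi * b ^ 2)).prod (lineMeasure (Real.pi * b ^ 2))) := by
  set c := Real.pi * b ^ 2 with hc
  have hc0 : 0 ≤ c := by positivity
  set K := ENNReal.ofReal (Real.exp (2 * Real.pi * b ^ 2 * (R + 1))) with hK
  set h' : ℝ × ℝ → ENNReal := fun y => ENNReal.ofReal (Real.exp (-(c * |y.1|))) *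
    ENNReal.ofReal (Real.exp (-(c * |y.2|))) * h y with hh'
  have hm' : Measurable h' := by fun_prop
  have hpt : ∀ p : ℝ × ℝ, |p.2| ≤ 1 → screeningWeight b t p * h (unrolledCone t p) ≤
      K * (‖deriv (contour t) p.1‖ₑ * h' (unrolledCone t p)) := by
    intro p hp
    have hexp : ENNReal.ofReal (Real.exp (-(2 * Real.pi * b ^ 2 * |(contour t p.1).re|))) ≤
        K * (ENNReal.ofReal (Real.exp (-(c * |(unrolledCone t p).1|))) *
          ENNReal.ofReal (Real.exp (-(c * |(unrolledCone t p).2|)))) := by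
      rw [hK, ← ENNReal.ofReal_mul (Real.exp_pos _).le, ← ENNReal.ofReal_mul (Real.exp_pos _).le,
        ← Real.exp_add, ← Real.exp_add]
      refine ENNReal.ofReal_le_ofReal (Real.exp_le_exp.2 ?_)
      have h1 : |(unrolledCone t p).1| ≤ |(contour t p.1).re| + R + 1 := by
        refine (abs_sub _ _).trans (add_le_add ((abs_add_le _ _).trans ?_) hp)
        exact add_le_add le_rfl (hR _)
      have h2 : |(unrolledCone t p).2| ≤ |(contour t p.1).re| + R + 1 := by
        refine (abs_add_le _ _).trans (add_le_add ((abs_add_le _ _).trans ?_) hp)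
        exact add_le_add le_rfl (hR _)
      have h3 := mul_le_mul_of_nonneg_left h1 hc0
      have h4 := mul_le_mul_of_nonneg_left h2 hc0
      rw [show 2 * Real.pi * b ^ 2 = 2 * c by rw [hc]; ring]
      linarith
    calc _ ≤ K * (ENNReal.ofReal (Real.exp (-(c * |(unrolledCone t p).1|))) *
          ENNReal.ofReal (Real.exp (-(c * |(unrolledCone t p).2|)))) *
            ‖deriv (contour t) p.1‖ₑ * h (unrolledCone t p) := by
          rw [screeningWeight]; gcongr
      _ = _ := by rw [hh']; ring
  have hmd : Measurable fun p : ℝ × ℝ => ‖deriv (contour t) p.1‖ₑ * h' (unrolledCone t p) := by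
    have := measurable_deriv (contour t)
    fun_prop
  calc _ ≤ ∫⁻ p, K * (‖deriv (contour t) p.1‖ₑ * h' (unrolledCone t p)) ∂cylinderMeasure :=
        lintegral_mono_ae (ae_cylinderMeasure_abs_le.mono hpt)
    _ = K * ∫⁻ p, ‖deriv (contour t) p.1‖ₑ * h' (unrolledCone t p) ∂cylinderMeasure :=
        lintegral_const_mul _ hmd
    _ ≤ K * ∫⁻ p : ℝ × ℝ, ‖deriv (contour t) p.1‖ₑ * h' (unrolledCone t p) := by
        gcongr; exact Measure.restrict_le_self
    _ = K * ∫⁻ x : ℝ, ∫⁻ s : ℝ, ‖deriv (contour t) s‖ₑ * h' (lightCone (unroll t s, x)) := by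
        rw [Measure.volume_eq_prod, lintegral_prod_symm _ hmd.aemeasurable]; rfl
    _ ≤ K * ∫⁻ x : ℝ, (k + 2) * ∫⁻ τ : ℝ, h' (lightCone (τ, x)) := by
        gcongr with x
        exact lintegral_deriv_contour_le t (h := fun τ => h' (lightCone (τ, x))) (by fun_prop)
    _ = K * ((k + 2) * ∫⁻ x : ℝ, ∫⁻ τ : ℝ, h' (lightCone (τ, x))) := by
        rw [lintegral_const_mul']
        exact ENNReal.add_ne_top.2 ⟨ENNReal.natCast_ne_top k, ENNReal.ofNat_ne_top⟩
    _ ≤ K * ((k + 2) * ∫⁻ y, h' y) := by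
        gcongr
        exact lintegral_lintegral_lightCone_le hm'
    _ = _ := by rw [lintegral_lineMeasure_prod c hh, mul_assoc]

/-- Integrals over the cylinder with exponential weight in time are bounded by integrals in
light-cone coordinates. -/
lemma lintegral_exp_mul_lightCone_le {c : ℝ} (hc0 : 0 ≤ c) {h : ℝ × ℝ → ENNReal}
    (hh : Measurable h) :
    ∫⁻ p, ENNReal.ofReal (Real.exp (-(2 * c * |p.1|))) * h (lightCone p) ∂cylinderMeasure ≤
      ENNReal.ofReal (Real.exp (2 * c)) *
        ∫⁻ y, h y ∂((lineMeasure c).prod (lineMeasure c)) := by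
  set K := ENNReal.ofReal (Real.exp (2 * c)) with hK
  set h' : ℝ × ℝ → ENNReal := fun y => ENNReal.ofReal (Real.exp (-(c * |y.1|))) *
    ENNReal.ofReal (Real.exp (-(c * |y.2|))) * h y with hh'
  have hm' : Measurable h' := by fun_prop
  have hpt : ∀ p : ℝ × ℝ, |p.2| ≤ 1 →
      ENNReal.ofReal (Real.exp (-(2 * c * |p.1|))) * h (lightCone p) ≤ K * h' (lightCone p) := by
    intro p hp
    rw [hh', ← mul_assoc]
    refine mul_le_mul' ?_ le_rfl
    rw [hK, ← ENNReal.ofReal_mul (Real.exp_pos _).le, ← ENNReal.ofReal_mul (Real.exp_pos _).le,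
      ← Real.exp_add, ← Real.exp_add]
    refine ENNReal.ofReal_le_ofReal (Real.exp_le_exp.2 ?_)
    have h1 : |(lightCone p).1| ≤ |p.1| + 1 := (abs_sub _ _).trans (add_le_add le_rfl hp)
    have h2 : |(lightCone p).2| ≤ |p.1| + 1 := (abs_add_le _ _).trans (add_le_add le_rfl hp)
    have h3 := mul_le_mul_of_nonneg_left h1 hc0
    have h4 := mul_le_mul_of_nonneg_left h2 hc0
    linarith
  calc _ ≤ ∫⁻ p, K * h' (lightCone p) ∂cylinderMeasure :=
        lintegral_mono_ae (ae_cylinderMeasure_abs_le.mono hpt)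
    _ = K * ∫⁻ p, h' (lightCone p) ∂cylinderMeasure := lintegral_const_mul _ (by fun_prop)
    _ ≤ K * ∫⁻ p : ℝ × ℝ, h' (lightCone p) := by
        gcongr; exact Measure.restrict_le_self
    _ = K * ∫⁻ x : ℝ, ∫⁻ τ : ℝ, h' (lightCone (τ, x)) := by
        rw [Measure.volume_eq_prod, lintegral_prod_symm _ (by fun_prop)]
    _ ≤ K * ∫⁻ y, h' y := by
        gcongr
        exact lintegral_lintegral_lightCone_le hm'
    _ = _ := by rw [lintegral_lineMeasure_prod c hh]

end Contour

/-! ### Measurability -/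

section Measurability

variable {k : ℕ} {X : Type*} [MeasurableSpace X]

lemma measurable_green {τ : X → ℂ} {x : X → ℝ} (hτ : Measurable τ) (hx : Measurable x) :
    Measurable fun a => green (τ a) (x a) := by
  unfold green; fun_prop

lemma measurable_contour {t : X → Fin (k + 1) → ℝ} {s : X → ℝ} (ht : Measurable t)
    (hs : Measurable s) : Measurable fun x => contour (t x) (s x) :=
  continuous_uncurry_contour.measurable.comp (ht.prodMk hs)

lemma measurable_orderedGreen {t : X → Fin (k + 1) → ℝ} {p q : X → ℝ × ℝ} (ht : Measurable t)
    (hp : Measurable p) (hq : Measurable q) :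
    Measurable fun x => orderedGreen (t x) (p x) (q x) := by
  have hcp := measurable_contour ht hp.fst
  have hcq := measurable_contour ht hq.fst
  have h1 := measurable_green (hcp.sub hcq) (hp.snd.sub hq.snd)
  have h2 := measurable_green (hcq.sub hcp) (hq.snd.sub hp.snd)
  exact Measurable.ite (measurableSet_le hq.fst hp.fst) h1 h2

lemma measurable_insertion (j : Fin (k + 1)) :
    Measurable fun v : Fin (k + 1) → ℝ × ℝ => insertion v j := by
  unfold insertion; fun_prop

lemma measurable_times : Measurable fun (v : Fin (k + 1) → ℝ × ℝ) (i : Fin (k + 1)) => (v i).1 := by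
  fun_prop

lemma measurable_externalFactor (α : Fin (k + 1) → ℂ) :
    Measurable fun v : Fin (k + 1) → ℝ × ℝ => Complex.exp (-4 * ∑ j, ∑ j' ∈ Finset.Ioi j,
        α j * α j' * orderedGreen (fun i => (v i).1) (insertion v j) (insertion v j')) := by
  have h := fun j j' => measurable_orderedGreen (measurable_times (k := k))
    (measurable_insertion j) (measurable_insertion j')
  fun_prop

lemma measurable_screeningIntegrand (b : ℝ) (w : ℕ) (α : Fin (k + 1) → ℂ) :
    Measurable fun p : (Fin (k + 1) → ℝ × ℝ) × (Fin w → ℝ × ℝ) =>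
      screeningIntegrand b w α p.1 p.2 := by
  have ht : Measurable fun p : (Fin (k + 1) → ℝ × ℝ) × (Fin w → ℝ × ℝ) =>
      fun i : Fin (k + 1) => (p.1 i).1 := by fun_prop
  have hu : ∀ l, Measurable fun p : (Fin (k + 1) → ℝ × ℝ) × (Fin w → ℝ × ℝ) => p.2 l := by
    intro l; fun_prop
  have h1 := fun j l => measurable_orderedGreen ht
    ((measurable_insertion (k := k) j).comp measurable_fst) (hu l)
  have h2 := fun l l' => measurable_orderedGreen ht (hu l) (hu l')
  have h3 := fun l => (measurable_deriv_with_param (𝕜 := ℝ)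
    (f := fun t : Fin (k + 1) → ℝ => contour t) continuous_uncurry_contour).comp
      (ht.prodMk (hu l).fst)
  simp only [Function.comp_def] at h1 h2 h3
  unfold screeningIntegrand
  fun_prop

lemma stronglyMeasurable_lorentzCorrelator (b μ : ℝ) (n : Fin (k + 1) → ℤ) :
    StronglyMeasurable (lorentzCorrelator b μ n) := by
  unfold lorentzCorrelator
  split_ifs
  · have h := (measurable_screeningIntegrand b (screeningNumber n).toNat
      (charges b n)).stronglyMeasurable.integral_prod_right'
      (ν := Measure.pi fun _ : Fin (screeningNumber n).toNat => cylinderMeasure)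
    exact ((measurable_externalFactor (charges b n)).stronglyMeasurable.const_mul _).mul h
  · exact stronglyMeasurable_const

end Measurability

/-! ### Test functions -/

lemma TestFn.measurable (f : TestFn) : Measurable f.1 := f.2.1.continuous.measurable

/-- A test function is dominated by any exponential in time, and vanishes at large times. -/
lemma TestFn.exists_bound (f : TestFn) (c : ℝ) : ∃ (K : ENNReal) (R : ℝ), K ≠ ⊤ ∧ 0 ≤ R ∧
    (∀ v, ‖f.1 v‖ₑ ≤ K * ENNReal.ofReal (Real.exp (-(c * |v.1|)))) ∧
    ∀ v, R < |v.1| → f.1 v = 0 := by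
  obtain ⟨hf, hper, R, hR⟩ := f.2
  obtain ⟨M, hM⟩ := (isCompact_Icc (a := ((-R, 0) : ℝ × ℝ)) (b := (R, 2))).exists_bound_of_continuousOn
    (hf.continuous.continuousOn (s := Set.Icc ((-R, 0) : ℝ × ℝ) (R, 2)))
  refine ⟨ENNReal.ofReal (|M| * Real.exp (|c| * |R|)), |R|, ENNReal.ofReal_ne_top, abs_nonneg R,
    fun v => ?_, fun v hv => hR v.1 v.2 ((le_abs_self R).trans_lt hv)⟩
  rcases lt_or_ge R |v.1| with hv | hv
  · rw [show f.1 v = 0 from hR v.1 v.2 hv]; simp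
  · obtain ⟨y, hy, hfy⟩ := Function.Periodic.exists_mem_Ico₀ (f := fun x => f.1 (v.1, x))
      (hper v.1) two_pos v.2
    have h1 : ‖f.1 v‖ ≤ |M| := by
      rw [show f.1 v = f.1 (v.1, y) from hfy]
      refine (hM _ ⟨⟨?_, hy.1⟩, ⟨?_, hy.2.le⟩⟩).trans (le_abs_self M)
      · exact (abs_le.1 hv).1
      · exact (abs_le.1 hv).2
    rw [← ofReal_norm, ← ENNReal.ofReal_mul (by positivity)]
    refine ENNReal.ofReal_le_ofReal (h1.trans ?_)
    rw [mul_assoc, ← Real.exp_add]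
    refine le_mul_of_one_le_right (abs_nonneg M) (Real.one_le_exp ?_)
    have h2 : c * |v.1| ≤ |c| * |R| :=
      mul_le_mul (le_abs_self c) (hv.trans (le_abs_self R)) (abs_nonneg _) (abs_nonneg _)
    linarith

lemma abs_contour_im_le {k : ℕ} (t : Fin (k + 1) → ℝ) {R : ℝ} (hR : ∀ j, |t j| ≤ R) (s : ℝ) :
    |(contour t s).im| ≤ (2 * k + 1) * R := by
  rw [contour_im]
  have h : |∑ j : Fin k, (t j.succ - t j.castSucc) * max 0 (min 1 (s - (j : ℕ)))| ≤
      ∑ _j : Fin k, 2 * R := by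
    refine (Finset.abs_sum_le_sum_abs _ _).trans (Finset.sum_le_sum fun j _ => ?_)
    rw [abs_mul, abs_of_nonneg (le_max_left (0 : ℝ) (min 1 (s - (j : ℕ))))]
    refine (mul_le_of_le_one_right (abs_nonneg _) (max_le zero_le_one (min_le_left _ _))).trans ?_
    exact (abs_sub _ _).trans (by linarith [hR j.succ, hR j.castSucc])
  rw [Finset.sum_const, Finset.card_univ, Fintype.card_fin, nsmul_eq_mul] at h
  refine (abs_add_le _ _).trans ?_
  linarith [hR 0]

/-! ### Charges -/

lemma exists_coupling_bound {b : ℝ} (hb : 0 < b) (hb' : b < 1 / Real.sqrt 2) {k : ℕ}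
    (n : Fin (k + 1) → chargeSet b) : ∃ s : ℝ, 0 < s ∧ 2 * s < 1 ∧
      (∀ j, b ^ 2 * ((n j : ℤ) : ℝ) ^ 2 ≤ s) ∧ b ^ 2 ≤ s := by
  have h2 : (0 : ℝ) < Real.sqrt 2 := Real.sqrt_pos.2 two_pos
  have hsq : Real.sqrt 2 ^ 2 = 2 := Real.sq_sqrt two_pos.le
  have hb2 : b ^ 2 < 1 / 2 := by
    have h := pow_lt_pow_left₀ hb' hb.le two_ne_zero
    rwa [div_pow, hsq, one_pow] at h
  have hn2 : ∀ j, b ^ 2 * ((n j : ℤ) : ℝ) ^ 2 < 1 / 2 := by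
    intro j
    have hj : |((n j : ℤ) : ℝ)| < 1 / (Real.sqrt 2 * b) := (n j).2
    have h := pow_lt_pow_left₀ hj (abs_nonneg _) two_ne_zero
    rw [sq_abs, div_pow, mul_pow, hsq, one_pow, lt_div_iff₀ (by positivity)] at h
    linarith
  have h : ∀ᶠ s in nhdsWithin (1 / 2 : ℝ) (Set.Iio (1 / 2)),
      (∀ j, b ^ 2 * ((n j : ℤ) : ℝ) ^ 2 ≤ s) ∧ b ^ 2 ≤ s := by
    refine (Filter.eventually_all.2 fun j => ?_).and ?_
    · filter_upwards [Ioo_mem_nhdsLT (hn2 j)] with s hs using hs.1.le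
    · filter_upwards [Ioo_mem_nhdsLT hb2] with s hs using hs.1.le
  obtain ⟨s, ⟨h3, h4⟩, h5⟩ := (h.and self_mem_nhdsWithin).exists
  refine ⟨s, (by positivity : 0 < b ^ 2).trans_le h4, ?_, h3, h4⟩
  have : s < 1 / 2 := h5
  linarith

/-! ### Convergence of the contour integral -/

lemma lintegral_pi_prod_le {X : Type*} [MeasurableSpace X] {ν : Measure X} [SigmaFinite ν]
    {a : X → ENNReal} (ha : Measurable a) (w : ℕ) :
    ∫⁻ u, ∏ l, a (u l) ∂(Measure.pi fun _ : Fin w => ν) ≤ (∫⁻ p, a p ∂ν) ^ w := by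
  have h := lintegral_pi_comp_le (ν := ν) (ν' := Measure.dirac ()) ha (measurable_const (a := ()))
    (C := ∫⁻ p, a p ∂ν) (fun g hg => by
      rw [lintegral_mul_const _ ha, lintegral_dirac' _ hg]) w (fun _ => 1) measurable_const
  simpa using h

lemma measurable_screeningWeight {k : ℕ} (b : ℝ) (t : Fin (k + 1) → ℝ) :
    Measurable (screeningWeight b t) := by
  have := measurable_deriv (contour t)
  unfold screeningWeight
  fun_prop

/-- The local singularities of a screening charge are integrable along the contour. -/
lemma lintegral_screeningWeight_mul_invChord_ne_top {b : ℝ} (hb : 0 < b) {k : ℕ}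
    (t : Fin (k + 1) → ℝ) (y : Fin (k + 1) → ℝ × ℝ) {p : ℝ} (hp : 0 ≤ p) (hp1 : p < 1) :
    ∫⁻ q, screeningWeight b t q * ((∑ j, invChord ((unrolledCone t q).1 - (y j).1) ^ p) *
      ∑ j, invChord ((unrolledCone t q).2 - (y j).2) ^ p) ∂cylinderMeasure ≠ ⊤ := by
  have hc : 0 < Real.pi * b ^ 2 := by positivity
  have hfin : ∀ θ : Fin (k + 1) → ℝ,
      ∫⁻ y, ∑ j, invChord (y - θ j) ^ p ∂(lineMeasure (Real.pi * b ^ 2)) ≠ ⊤ := by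
    intro θ
    obtain ⟨C', hC', h⟩ := lintegral_invChord_rpow_sub_le hc hp hp1
    rw [lintegral_finsetSum _ (by fun_prop)]
    exact ENNReal.sum_ne_top.2 fun j _ => ne_top_of_le_ne_top hC' (h _)
  have hgm : Measurable fun z : ℝ × ℝ => (∑ j, invChord (z.1 - (y j).1) ^ p) *
      ∑ j, invChord (z.2 - (y j).2) ^ p := by fun_prop
  have hR : ∀ s, |(contour t s).im| ≤ (2 * k + 1) * ∑ j, |t j| := abs_contour_im_le t fun j =>
    Finset.single_le_sum (f := fun j => |t j|) (fun _ _ => abs_nonneg _) (Finset.mem_univ j)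
  refine ne_top_of_le_ne_top ?_ (lintegral_screeningWeight_le t b hR hgm)
  rw [lintegral_prod_mul (f := fun z => ∑ j, invChord (z - (y j).1) ^ p)
    (g := fun z => ∑ j, invChord (z - (y j).2) ^ p) (by fun_prop) (by fun_prop)]
  refine ENNReal.mul_ne_top (ENNReal.mul_ne_top ENNReal.ofReal_ne_top ?_)
    (ENNReal.mul_ne_top (hfin _) (hfin _))
  exact ENNReal.add_ne_top.2 ⟨ENNReal.natCast_ne_top k, ENNReal.ofNat_ne_top⟩

lemma abs_two_mul_sq_mul_le {b m s : ℝ} (hm : b ^ 2 * m ^ 2 ≤ s) (hb : b ^ 2 ≤ s) :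
    |2 * b ^ 2 * m| ≤ 2 * s := by
  rw [abs_le]
  constructor <;> nlinarith [sq_nonneg (b * m - b), sq_nonneg (b * m + b)]

lemma measurable_screeningIntegrand_right {k : ℕ} (b : ℝ) (w : ℕ) (α : Fin (k + 1) → ℂ)
    (v : Fin (k + 1) → ℝ × ℝ) : Measurable (screeningIntegrand b w α v) :=
  Measurable.of_uncurry_left (f := screeningIntegrand b w α) (measurable_screeningIntegrand b w α)

lemma integrable_screeningIntegrand {b : ℝ} (hb : 0 < b) (hb' : b < 1 / Real.sqrt 2) {k : ℕ}
    (n : Fin (k + 1) → chargeSet b) (v : Fin (k + 1) → ℝ × ℝ) (hv : NonLightCone v) (w : ℕ)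
    (hw : screeningNumber (fun j => (n j : ℤ)) = w) :
    Integrable (screeningIntegrand b w (charges b fun j => (n j : ℤ)) v)
      (Measure.pi fun _ => cylinderMeasure) := by
  obtain ⟨s, hs, hs1, hns, hbs⟩ := exists_coupling_bound hb hb' n
  have hn : ∑ j, (n j : ℤ) = -(w : ℤ) := by rw [← hw, screeningNumber, neg_neg]
  have hna : ∀ j, |2 * b ^ 2 * ((n j : ℤ) : ℝ)| ≤ 2 * s := fun j =>
    abs_two_mul_sq_mul_le (hns j) hbs
  obtain ⟨C, hC, hbound⟩ := enorm_screeningIntegrand_le b (fun j => (n j : ℤ)) hn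
    (by linarith : 0 < 2 * s) hna v hv
  refine ⟨(measurable_screeningIntegrand_right b w _ v).aestronglyMeasurable, ?_⟩
  have hone := lintegral_screeningWeight_mul_invChord_ne_top hb (fun i => (v i).1)
    (fun j => lightCone (v j)) (by linarith : 0 ≤ 2 * s) hs1
  have hwm : Measurable fun p => screeningWeight b (fun i => (v i).1) p *
      ((∑ j, invChord ((unrolledCone (fun i => (v i).1) p).1 - (lightCone (v j)).1) ^ (2 * s)) *
      ∑ j, invChord ((unrolledCone (fun i => (v i).1) p).2 - (lightCone (v j)).2) ^ (2 * s)) := by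
    have := measurable_screeningWeight b fun i => (v i).1
    have := (continuous_unrolledCone fun i => (v i).1).measurable
    fun_prop
  rw [hasFiniteIntegral_iff_enorm]
  refine (lintegral_mono hbound).trans_lt ?_
  rw [lintegral_const_mul' _ _ hC]
  refine (mul_le_mul_right (lintegral_pi_prod_le hwm w) C).trans_lt ?_
  exact (ENNReal.mul_ne_top hC (ENNReal.pow_ne_top hone)).lt_top

/-! ### Convergence of the smeared expectations -/

/-- The crowding of external and screening points in both light-cone coordinates. -/
def coneCrowding {k w : ℕ} (s : ℝ) (y : Fin (k + 1) → ℝ × ℝ) (z : Fin w → ℝ × ℝ) : ENNReal :=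
  crowding s (Sum.elim (fun j => (y j).1) fun l => (z l).1) *
    crowding s (Sum.elim (fun j => (y j).2) fun l => (z l).2)

lemma measurable_coneCrowding {k w : ℕ} (s : ℝ) :
    Measurable fun p : (Fin (k + 1) → ℝ × ℝ) × (Fin w → ℝ × ℝ) => coneCrowding s p.1 p.2 := by
  have h1 : Measurable fun p : (Fin (k + 1) → ℝ × ℝ) × (Fin w → ℝ × ℝ) =>
      Sum.elim (fun j => (p.1 j).1) fun l => (p.2 l).1 := by
    refine measurable_pi_iff.2 ?_
    rintro (j | l) <;> simp only [Sum.elim_inl, Sum.elim_inr] <;> fun_prop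
  have h2 : Measurable fun p : (Fin (k + 1) → ℝ × ℝ) × (Fin w → ℝ × ℝ) =>
      Sum.elim (fun j => (p.1 j).2) fun l => (p.2 l).2 := by
    refine measurable_pi_iff.2 ?_
    rintro (j | l) <;> simp only [Sum.elim_inl, Sum.elim_inr] <;> fun_prop
  exact ((measurable_crowding s).comp h1).mul ((measurable_crowding s).comp h2)

lemma lintegral_coneCrowding_ne_top {k w : ℕ} {c s : ℝ} (hc : 0 < c) (hs : 0 < s)
    (hs1 : 2 * s < 1) :
    ∫⁻ y : Fin (k + 1) → ℝ × ℝ, ∫⁻ z : Fin w → ℝ × ℝ, coneCrowding s y z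
      ∂(Measure.pi fun _ => (lineMeasure c).prod (lineMeasure c))
      ∂(Measure.pi fun _ => (lineMeasure c).prod (lineMeasure c)) ≠ ⊤ := by
  set ν := (lineMeasure c).prod (lineMeasure c) with hν
  have h1 := lintegral_prod (μ := Measure.pi fun _ : Fin (k + 1) => ν)
    (ν := Measure.pi fun _ : Fin w => ν) _
    (measurable_coneCrowding (k := k) (w := w) s).aemeasurable
  dsimp only at h1
  rw [← h1]
  have h2 := (measurePreserving_sumPiEquivProdPi
    (fun _ : Fin (k + 1) ⊕ Fin w => ν)).lintegral_comp_emb (MeasurableEquiv.measurableEmbedding _)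
    (fun p => coneCrowding s p.1 p.2)
  rw [← h2]
  have h3 : ∀ x : Fin (k + 1) ⊕ Fin w → ℝ × ℝ,
      coneCrowding s (MeasurableEquiv.sumPiEquivProdPi (fun _ => ℝ × ℝ) x).1
        (MeasurableEquiv.sumPiEquivProdPi (fun _ => ℝ × ℝ) x).2 =
      crowding s (MeasurableEquiv.arrowProdEquivProdArrow ℝ ℝ (Fin (k + 1) ⊕ Fin w) x).1 *
        crowding s (MeasurableEquiv.arrowProdEquivProdArrow ℝ ℝ (Fin (k + 1) ⊕ Fin w) x).2 := by
    intro x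
    rw [coneCrowding]
    congr 2 <;> funext i <;> cases i <;> rfl
  simp only [h3]
  have h4 := (measurePreserving_arrowProdEquivProdArrow ℝ ℝ (Fin (k + 1) ⊕ Fin w)
    (fun _ => lineMeasure c) fun _ => lineMeasure c).lintegral_comp_emb
    (MeasurableEquiv.measurableEmbedding _) (fun p => crowding s p.1 * crowding s p.2)
  rw [hν, h4, lintegral_prod_mul (by fun_prop) (by fun_prop)]
  exact ENNReal.mul_ne_top (lintegral_crowding_ne_top hc hs hs1)
    (lintegral_crowding_ne_top hc hs hs1)

/-- The crowding integrated over the screening points, as a function of the external points. -/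
def screenedCrowding {k : ℕ} (b s : ℝ) (w : ℕ) (y : Fin (k + 1) → ℝ × ℝ) : ENNReal :=
  ∫⁻ z : Fin w → ℝ × ℝ, coneCrowding s y z
    ∂(Measure.pi fun _ => (lineMeasure (Real.pi * b ^ 2)).prod (lineMeasure (Real.pi * b ^ 2)))

lemma measurable_screenedCrowding {k : ℕ} (b s : ℝ) (w : ℕ) :
    Measurable (screenedCrowding (k := k) b s w) :=
  (measurable_coneCrowding s).lintegral_prod_right'

lemma lintegral_screening_coneCrowding_le {k w : ℕ} (b s : ℝ) (t : Fin (k + 1) → ℝ)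
    (y : Fin (k + 1) → ℝ × ℝ) {R : ℝ} (hR : ∀ j, |t j| ≤ R) :
    ∫⁻ u : Fin w → ℝ × ℝ, (∏ l, screeningWeight b t (u l)) *
        coneCrowding s y (fun l => unrolledCone t (u l)) ∂(Measure.pi fun _ => cylinderMeasure) ≤
      (ENNReal.ofReal (Real.exp (2 * Real.pi * b ^ 2 * ((2 * k + 1) * R + 1))) * (k + 2)) ^ w *
        screenedCrowding b s w y := by
  have hHm : Measurable (coneCrowding (w := w) s y) :=
    Measurable.of_uncurry_left (f := coneCrowding (w := w) s) (measurable_coneCrowding s)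
  exact lintegral_pi_comp_le (measurable_screeningWeight b t)
    (continuous_unrolledCone t).measurable
    (fun g hg => lintegral_screeningWeight_le t b (abs_contour_im_le t hR) hg) w
    (coneCrowding s y) hHm

lemma enorm_mul_mul_integral_le {X : Type*} [MeasurableSpace X] {ν : Measure X} (M E : ℂ)
    (F : X → ℂ) : ‖M * E * ∫ u, F u ∂ν‖ₑ ≤ ‖M‖ₑ * ∫⁻ u, ‖E‖ₑ * ‖F u‖ₑ ∂ν := by
  rw [mul_assoc, enorm_mul, enorm_mul, lintegral_const_mul' _ _ enorm_ne_top]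
  gcongr
  exact enorm_integral_le_lintegral_enorm _

lemma enorm_screenedCorrelator_le {k w : ℕ} (b μ : ℝ) (n : Fin (k + 1) → ℤ)
    (hn : ∑ j, n j = -(w : ℤ)) {s : ℝ} (hs : 0 < s) (hns : ∀ j, b ^ 2 * (n j : ℝ) ^ 2 ≤ s)
    (hbs : b ^ 2 ≤ s) (R : ℝ) :
    ∃ D : ENNReal, D ≠ ⊤ ∧ ∀ v : Fin (k + 1) → ℝ × ℝ, (∀ j, |(v j).1| ≤ R) →
      ‖screenedCorrelator b μ w (charges b n) v‖ₑ ≤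
        D * screenedCrowding b s w fun j => lightCone (v j) := by
  obtain ⟨C, hC, hbound⟩ := enorm_integrand_le b n hn hs hns hbs
  set A : ENNReal := ENNReal.ofReal (Real.exp (2 * Real.pi * b ^ 2 * ((2 * k + 1) * R + 1))) *
    (k + 2) with hA
  have hAtop : A ≠ ⊤ := ENNReal.mul_ne_top ENNReal.ofReal_ne_top
    (ENNReal.add_ne_top.2 ⟨ENNReal.natCast_ne_top k, ENNReal.ofNat_ne_top⟩)
  refine ⟨‖(((-μ) ^ w / (w.factorial : ℝ) : ℝ) : ℂ)‖ₑ * (C * A ^ w), ENNReal.mul_ne_top enorm_ne_top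
    (ENNReal.mul_ne_top hC (ENNReal.pow_ne_top hAtop)), fun v hv => ?_⟩
  rw [screenedCorrelator, mul_assoc ‖_‖ₑ, mul_assoc C]
  refine (enorm_mul_mul_integral_le _ _ _).trans ?_
  gcongr
  refine (lintegral_mono (hbound v)).trans ?_
  rw [lintegral_const_mul' _ _ hC]
  gcongr
  exact lintegral_screening_coneCrowding_le b s (fun i => (v i).1) (fun j => lightCone (v j)) hv

lemma lintegral_exp_mul_screenedCrowding_ne_top {k : ℕ} {b s : ℝ} (hb : 0 < b) (hs : 0 < s)
    (hs1 : 2 * s < 1) (w : ℕ) :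
    ∫⁻ v : Fin (k + 1) → ℝ × ℝ,
      (∏ j, ENNReal.ofReal (Real.exp (-(2 * (Real.pi * b ^ 2) * |(v j).1|)))) *
        screenedCrowding b s w (fun j => lightCone (v j))
      ∂(Measure.pi fun _ => cylinderMeasure) ≠ ⊤ := by
  have hc0 : 0 < Real.pi * b ^ 2 := by positivity
  refine ne_top_of_le_ne_top ?_ (lintegral_pi_comp_le (ν := cylinderMeasure)
    (a := fun p => ENNReal.ofReal (Real.exp (-(2 * (Real.pi * b ^ 2) * |p.1|)))) (by fun_prop)
    continuous_lightCone.measurable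
    (fun g hg => lintegral_exp_mul_lightCone_le hc0.le hg) (k + 1) _
    (measurable_screenedCrowding b s w))
  exact ENNReal.mul_ne_top (ENNReal.pow_ne_top ENNReal.ofReal_ne_top)
    (lintegral_coneCrowding_ne_top hc0 hs hs1)

lemma measurable_prod_testFn {k : ℕ} (f : Fin (k + 1) → TestFn) :
    Measurable fun u : Fin (k + 1) → ℝ × ℝ => ∏ j, (f j).1 (u j) :=
  Finset.measurable_fun_prod _ fun j _ =>
    (TestFn.measurable (f j)).comp (measurable_pi_apply j)

/-- A product of test functions is dominated by exponentials in time, and is supported at bounded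
times. -/
lemma exists_prod_testFn_bound {k : ℕ} (f : Fin (k + 1) → TestFn) (c : ℝ) :
    ∃ (K : ENNReal) (R : ℝ), K ≠ ⊤ ∧ ∀ v : Fin (k + 1) → ℝ × ℝ,
      ‖∏ j, (f j).1 (v j)‖ₑ ≤ K * ∏ j, ENNReal.ofReal (Real.exp (-(c * |(v j).1|))) ∧
      (∏ j, (f j).1 (v j) = 0 ∨ ∀ j, |(v j).1| ≤ R) := by
  choose K R hK hR0 hfK hfR using fun j => TestFn.exists_bound (f j) c
  refine ⟨∏ j, K j, ∑ j, R j, ENNReal.prod_ne_top fun j _ => hK j, fun v => ⟨?_, ?_⟩⟩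
  · have e : ‖∏ j, (f j).1 (v j)‖ₑ = ∏ j, ‖(f j).1 (v j)‖ₑ := by
      simp only [← ofReal_norm, norm_prod]
      exact ENNReal.ofReal_prod_of_nonneg fun _ _ => norm_nonneg _
    rw [← Finset.prod_mul_distrib, e]
    exact Finset.prod_le_prod' fun j _ => hfK j (v j)
  · refine or_iff_not_imp_left.2 fun h j => ?_
    have hj : (f j).1 (v j) ≠ 0 := Finset.prod_ne_zero_iff.1 h j (Finset.mem_univ j)
    refine (not_lt.1 fun h => hj (hfR j _ h)).trans ?_
    exact Finset.single_le_sum (fun i _ => hR0 i) (Finset.mem_univ j)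

lemma integrable_smearedIntegrand {b μ : ℝ} (hb : 0 < b) (hb' : b < 1 / Real.sqrt 2) {k : ℕ}
    (f : Fin (k + 1) → TestFn) (n : Fin (k + 1) → chargeSet b) :
    Integrable (smearedIntegrand μ f n) (Measure.pi fun _ => cylinderMeasure) := by
  refine ⟨((measurable_prod_testFn f).stronglyMeasurable.mul
    (stronglyMeasurable_lorentzCorrelator b μ _)).aestronglyMeasurable, ?_⟩
  rw [hasFiniteIntegral_iff_enorm]
  by_cases hw0 : 0 ≤ screeningNumber fun j => (n j : ℤ)
  swap
  · have h : ∀ u, smearedIntegrand μ f n u = 0 := fun u => by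
      rw [smearedIntegrand, lorentzCorrelator, if_neg hw0, mul_zero]
    simp [h]
  set w := (screeningNumber fun j => (n j : ℤ)).toNat with hw
  have hn : ∑ j, (n j : ℤ) = -(w : ℤ) := by
    rw [hw, Int.toNat_of_nonneg hw0, screeningNumber, neg_neg]
  obtain ⟨s, hs, hs1, hns, hbs⟩ := exists_coupling_bound hb hb' n
  obtain ⟨K, R, hK, hfK⟩ := exists_prod_testFn_bound f (2 * (Real.pi * b ^ 2))
  obtain ⟨D, hD, hcorr⟩ := enorm_screenedCorrelator_le b μ (fun j => (n j : ℤ)) hn hs hns hbs R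
  have hpt : ∀ v, ‖smearedIntegrand μ f n v‖ₑ ≤ K * D *
      ((∏ j, ENNReal.ofReal (Real.exp (-(2 * (Real.pi * b ^ 2) * |(v j).1|)))) *
        screenedCrowding b s w fun j => lightCone (v j)) := by
    intro v
    rw [smearedIntegrand, enorm_mul, lorentzCorrelator, if_pos hw0]
    rcases (hfK v).2 with h | h
    · simp [h]
    · exact (mul_le_mul' (hfK v).1 (hcorr v h)).trans_eq (by ring)
  refine (lintegral_mono hpt).trans_lt ?_
  rw [lintegral_const_mul' _ _ (ENNReal.mul_ne_top hK hD)]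
  exact (ENNReal.mul_ne_top (ENNReal.mul_ne_top hK hD)
    (lintegral_exp_mul_screenedCrowding_ne_top hb hs hs1 w)).lt_top

end TimelikeLiouville

end

theorem theorem2p5 (b μ : ℝ) (hb : 0 < b) (hb' : b < 1 / Real.sqrt 2) (hμ : 0 < μ) :
    -- the smeared expectations converge absolutely
    (∀ (k : ℕ) (f : Fin (k + 1) → TimelikeLiouville.TestFn)
        (n : Fin (k + 1) → TimelikeLiouville.chargeSet b),
      MeasureTheory.Integrable (TimelikeLiouville.smearedIntegrand μ f n)
        (MeasureTheory.Measure.pi fun _ => TimelikeLiouville.cylinderMeasure)) ∧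
    -- the vacuum functional exists and is unique
    (∃! ω : TimelikeLiouville.Alg b →ₗ[ℂ] ℂ, TimelikeLiouville.IsVacuumFunctional b μ ω) ∧
    -- the form `⟨A, B⟩ = ω (A* B)` is Hermitian
    (∀ ω : TimelikeLiouville.Alg b →ₗ[ℂ] ℂ, TimelikeLiouville.IsVacuumFunctional b μ ω →
      ∀ A B : TimelikeLiouville.Alg b,
        ω (star A * B) = starRingEnd ℂ (ω (star B * A))) ∧
    -- the pointwise reversal identity, with an absolutely convergent contour integral
    (∀ (k : ℕ) (n : Fin (k + 1) → TimelikeLiouville.chargeSet b) (v : Fin (k + 1) → ℝ × ℝ),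
      TimelikeLiouville.NonLightCone v →
        (∀ w : ℕ, TimelikeLiouville.screeningNumber (fun j => (n j : ℤ)) = w →
          MeasureTheory.Integrable
            (TimelikeLiouville.screeningIntegrand b w
              (TimelikeLiouville.charges b fun j => (n j : ℤ)) v)
            (MeasureTheory.Measure.pi fun _ => TimelikeLiouville.cylinderMeasure)) ∧
        TimelikeLiouville.lorentzCorrelator b μ (fun j => (n j : ℤ)) v =
          starRingEnd ℂ (TimelikeLiouville.lorentzCorrelator b μ
            (fun j => (n j.rev : ℤ)) (fun j => v j.rev))) := by
  have hint := fun k f n =>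
    TimelikeLiouville.integrable_smearedIntegrand (μ := μ) (k := k) hb hb' f n
  have hvac := TimelikeLiouville.isVacuumFunctional_vacuumFunctional hint
  refine ⟨hint, ⟨_, hvac, fun ω h => h.unique hvac⟩, fun ω h A B => h.hermitian A B,
    fun k n v hv => ⟨TimelikeLiouville.integrable_screeningIntegrand hb hb' n v hv, ?_⟩⟩
  rw [TimelikeLiouville.lorentzCorrelator_rev b μ (fun j => (n j : ℤ)) v, Complex.conj_conj]
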